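/- Let $K(z)=\bar z/z^2$ for $z\in\mathbb C\setminus\{0\}$, let $B(z,\rho)$ denote the closed disc with centre $z$ and radius $\rho$, let $A(z,\rho)=B(z,\rho)\setminus B(z,\rho/2)$, and let $m_2$ be Lebesgue measure on $\mathbb C$ normalized so that $m_2(B(0,1))=1$. *Scales.* Let $r_0=1$ and let $(r_n)_{n\ge 0}$ be positive numbers with $r_{n+1}<r_n/100$, $1/r_n\in\mathbb N$ and $r_n/r_{n+1}\in\mathbb N$ for all $n\ge 0$. Put $s_{n+1}=4\sqrt{r_{n+1}/r_n}$ and assume that $\sum_{n\ge1}\sqrt{s_n}<\infty$. *Construction.* Start with the single generation-$0$ disc $\widetilde B^{(0)}_1=B(0,1)$. Given the $1/r_n$ generation-$n$ discs $\widetilde B^{(n)}_j$ of radius $r_n$, choose for each $j$ a collection of $r_n/r_{n+1}$ closed squares of side length $\sqrt{\pi r_nr_{n+1}}$ with pairwise disjoint interiors, all contained in the concentric enlargement $B^{(n)}_j=(1+s_{n+1})\widetilde B^{(n)}_j$; the generation-$(n+1)$ discs are the closed discs of radius $r_{n+1}$ centred at the centres of all the squares so obtained (over all $j$). Let $\mu^{(n)}=\sum_j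 \frac1{r_n}\chi_{\widetilde B^{(n)}_j}m_2$, and let $\mu$ be the weak limit of a subsequence of $(\mu^{(n)})$. *Theorem.* There is an absolute constant $c_0>0$ such that, for every such sequence $(r_n)$, there is an $N$ (depending only on $(r_n)$) such that, for every construction and every measure $\mu$ as above: 1. for all $n\ge N$, every generation-$n$ index $j$ and every $z\in\mathbb C$ with $\operatorname{dist}(z,\partial B^{(n)}_j)\le c_0r_n$, $$\Bigl|\int_{A(z,r_n)}K(z-\xi)\,d\mu(\xi)\Bigr|\ge c_0;$$ 2. for $\mu$-almost every $z$ there are infinitely many $n$ such that $\operatorname{dist}(z,\partial B^{(n)}_j)\le c_0r_n$ for some $j$; 3. for $\mu$-almost every $z\in\mathbb C$, $T_\mu(1)(z)$ fails to exist in the sense of principal value, that is, the limit $\lim_{\varepsilon\to0^+}\int_{|z-\xi|>\varepsilon}K(z-\xi)\,d\mu(\xi)$ does not exist in $\mathbb C$. -/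

import Mathlib

open MeasureTheory Filter Topology

noncomputable section

namespace SparseCantor

/-- The kernel `K(z) = conj z / z ^ 2` (with the irrelevant value `0` at `z = 0`). -/
def K (z : ℂ) : ℂ := (starRingEnd ℂ) z / z ^ 2

/-- Two-dimensional Lebesgue measure, normalized so that the unit disc has measure `1`. -/
def m₂ : Measure ℂ := ENNReal.ofReal (1 / Real.pi) • (volume : Measure ℂ)

/-- The annulus `A(z, ρ) = B(z, ρ) \ B(z, ρ / 2)`, the discs being closed. -/
def annulus (z : ℂ) (ρ : ℝ) : Set ℂ := Metric.closedBall z ρ \ Metric.closedBall z (ρ / 2)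

/-- The closed square with centre `c` and side length `a`, whose sides are parallel to the unit
complex numbers `u` and `i * u`. -/
def square (c : ℂ) (a : ℝ) (u : Circle) : Set ℂ :=
  (fun w : ℂ => c + (u : ℂ) * w) '' {w : ℂ | |w.re| ≤ a / 2 ∧ |w.im| ≤ a / 2}

/-- `S` is the set of centres of `R / ρ` closed squares with side length `√(π ρ R)` and pairwise
disjoint interiors, all of them contained in the closed disc of radius `R (1 + 4 √(ρ / R))`
about `z`. -/
def IsSquarePacking (z : ℂ) (R ρ : ℝ) (S : Finset ℂ) : Prop :=
  (S.card : ℝ) = R / ρ ∧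
  ∃ u : ℂ → Circle,
    (∀ c ∈ S, square c √(Real.pi * ρ * R) (u c) ⊆
      Metric.closedBall z (R * (1 + 4 * √(ρ / R)))) ∧
    ∀ c ∈ S, ∀ c' ∈ S, c ≠ c' →
      Disjoint (interior (square c √(Real.pi * ρ * R) (u c)))
        (interior (square c' √(Real.pi * ρ * R) (u c')))

/-- The parameter `s_{n+1} = 4 √(r_{n+1} / r_n)`. -/
def sNext (r : ℕ → ℝ) (n : ℕ) : ℝ := 4 * √(r (n + 1) / r n)

/-- The requirements on the sequence of scales: `r_0 = 1`, `0 < r_{j+1} < r_j / 100`, the numbers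
`1 / r_j` and `r_j / r_{j+1}` are integers, and `∑_{n ≥ 1} √(s_n) < ∞`. -/
structure IsScaleSequence (r : ℕ → ℝ) : Prop where
  zero : r 0 = 1
  pos : ∀ j, 0 < r j
  lt : ∀ j, r (j + 1) < r j / 100
  inv_nat : ∀ j, ∃ k : ℕ, 1 / r j = k
  ratio_nat : ∀ j, ∃ k : ℕ, r j / r (j + 1) = k
  summable : Summable fun n => √(sNext r n)

/-- A run of the sparse Cantor construction with scales `r`: `centers n` is the set of centres of
the generation-`n` discs (all of radius `r n`), starting with the closed unit disc. Each
generation-`n` disc, with centre `z`, is replaced by the discs of radius `r (n + 1)` centred at the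
centres `children n z` of a square packing associated with that disc. -/
structure Construction (r : ℕ → ℝ) where
  centers : ℕ → Finset ℂ
  children : ℕ → ℂ → Finset ℂ
  centers_zero : centers 0 = {0}
  packing : ∀ n, ∀ z ∈ centers n, IsSquarePacking z (r n) (r (n + 1)) (children n z)
  centers_succ : ∀ n, centers (n + 1) = (centers n).biUnion (children n)

/-- The enlarged generation-`n` disc `B^{(n)} = B(z, (1 + s_{n+1}) r_n)` about a centre `z`. -/
def bigDisc (r : ℕ → ℝ) (n : ℕ) (z : ℂ) : Set ℂ :=
  Metric.closedBall z ((1 + sNext r n) * r n)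

/-- The measure `μ^{(n)} = ∑_j (1 / r_n) χ_{B(z_j, r_n)} m₂`, the sum being over the centres `z_j`
of the generation-`n` discs. -/
def Construction.approxMeasure {r : ℕ → ℝ} (C : Construction r) (n : ℕ) : Measure ℂ :=
  ∑ z ∈ C.centers n, ENNReal.ofReal (1 / r n) • m₂.restrict (Metric.closedBall z (r n))

theorem Construction.isFiniteMeasure_approxMeasure {r : ℕ → ℝ} (C : Construction r) (n : ℕ) :
    IsFiniteMeasure (C.approxMeasure n) := by
  refine ⟨?_⟩
  simp only [approxMeasure, m₂, Measure.finsetSum_apply, Measure.smul_apply, smul_eq_mul,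
    Measure.restrict_apply MeasurableSet.univ, Set.univ_inter]
  refine ENNReal.sum_lt_top.2 fun z _ => ENNReal.mul_lt_top ENNReal.ofReal_lt_top
    (ENNReal.mul_lt_top ENNReal.ofReal_lt_top measure_closedBall_lt_top)

/-- `μ^{(n)}` as a finite measure, so that Mathlib's weak convergence applies to it. -/
def Construction.approx {r : ℕ → ℝ} (C : Construction r) (n : ℕ) : FiniteMeasure ℂ :=
  ⟨C.approxMeasure n, C.isFiniteMeasure_approxMeasure n⟩

/-- `μ` is the weak limit of some subsequence of the measures `μ^{(n)}`. -/
def Construction.IsWeakSubseqLimit {r : ℕ → ℝ} (C : Construction r) (μ : FiniteMeasure ℂ) : Prop :=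
  ∃ φ : ℕ → ℕ, StrictMono φ ∧ Tendsto (fun k => C.approx (φ k)) atTop (𝓝 μ)

/-- The truncated singular integral `∫_{|z - ξ| > ε} K(z - ξ) dμ(ξ)`. -/
def truncatedIntegral (μ : Measure ℂ) (ε : ℝ) (z : ℂ) : ℂ :=
  ∫ ξ in {ξ : ℂ | ε < ‖z - ξ‖}, K (z - ξ) ∂μ

/-- `T_μ(1)(z)` exists in the sense of principal value. -/
def PrincipalValueExists (μ : Measure ℂ) (z : ℂ) : Prop :=
  ∃ L : ℂ, Tendsto (fun ε => truncatedIntegral μ ε z) (𝓝[>] (0 : ℝ)) (𝓝 L)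

end SparseCantor

end

/-! Seen at scale `r n` from a point near the boundary of an enlarged disc, `μ` is almost normalized
Lebesgue measure on that disc, so the annulus integral is almost a fixed nonzero number; since
`μ`-almost every point is near such boundaries infinitely often, principal values cannot exist.

Masses: the enlarged discs are nested along generations and disjoint within one. Weak convergence
gives each closed disc mass at least `r n`; there are `1 / r n` of them and the total mass is 1, so
each has mass exactly `r n` and together they carry `μ` (`measureReal_bigDisc`, `ae_mem_bigDisc`).

Lower bound: inside one disc, each child of mass `r (n + 1)` sits in a square of area `π * r (n + 1)
* r n`, and the squares fill the disc up to a relative area `O(sNext r n)`. Replacing `μ` by `(π * r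
n)⁻¹` times area thus costs `O(sNext r n)`, and other discs of the generation do not meet the
annulus. The kernel is multiplicative, so scaling and rotating reduces the area integral to `∫ η in
lens, K η`. In polar coordinates the real part of `K` is `cos (3θ) / t`, and the angular integral is
negative for every `t` in `(1/2, 1)`.

Recurrence: by area, at most a fraction `(1 - κ/2)^2` of the children of a disc reach points farther
than `κ * r n` from its boundary. Iterating over generations, the set of points far from all
boundaries from some generation on is null.

Divergence: the annulus integral is the difference of the truncations at `ρ / 2` and `ρ`, which
would tend to 0 if the principal value existed. -/

namespace SparseCantor

/-! ### Open squares -/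

/-- The open square with centre `c` and side length `a`, rotated by `u`. -/
def openSquare (c : ℂ) (a : ℝ) (u : Circle) : Set ℂ :=
  (fun ξ : ℂ => rotation u⁻¹ (ξ - c)) ⁻¹' {w : ℂ | |w.re| < a / 2 ∧ |w.im| < a / 2}

theorem isOpen_openBox (a : ℝ) : IsOpen {w : ℂ | |w.re| < a / 2 ∧ |w.im| < a / 2} :=
  (isOpen_lt Complex.continuous_re.abs continuous_const).inter
    (isOpen_lt Complex.continuous_im.abs continuous_const)

theorem isOpen_openSquare (c : ℂ) (a : ℝ) (u : Circle) : IsOpen (openSquare c a u) := by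
  exact (isOpen_openBox a).preimage (by fun_prop)

/-- Transfers the disjointness of the interiors to sets whose openness and area are immediate from
an isometry. -/
theorem openSquare_subset_interior_square (c : ℂ) (a : ℝ) (u : Circle) :
    openSquare c a u ⊆ interior (square c a u) := by
  refine interior_maximal ?_ (isOpen_openSquare c a u)
  intro ξ hξ
  refine ⟨rotation u⁻¹ (ξ - c), ⟨hξ.1.le, hξ.2.le⟩, ?_⟩
  simp only [rotation_apply, Circle.coe_inv]
  field_simp [u.coe_ne_zero]
  ring

theorem ball_subset_openSquare (c : ℂ) (a : ℝ) (u : Circle) :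
    Metric.ball c (a / 2) ⊆ openSquare c a u := by
  intro ξ hξ
  have h : ‖rotation u⁻¹ (ξ - c)‖ < a / 2 := by
    rw [LinearIsometryEquiv.norm_map]
    simpa [dist_eq_norm] using hξ
  exact ⟨(Complex.abs_re_le_norm _).trans_lt h, (Complex.abs_im_le_norm _).trans_lt h⟩

theorem openSquare_subset_ball (c : ℂ) (a : ℝ) (u : Circle) :
    openSquare c a u ⊆ Metric.ball c a := by
  intro ξ hξ
  have h : ‖rotation u⁻¹ (ξ - c)‖ < a := by
    have h1 := Complex.norm_le_abs_re_add_abs_im (rotation u⁻¹ (ξ - c))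
    have h2 := hξ.1
    have h3 := hξ.2
    linarith
  rw [LinearIsometryEquiv.norm_map] at h
  simpa [dist_eq_norm] using h

theorem volume_openBox (a : ℝ) (ha : 0 ≤ a) :
    volume {w : ℂ | |w.re| < a / 2 ∧ |w.im| < a / 2} = ENNReal.ofReal (a ^ 2) := by
  have h : {w : ℂ | |w.re| < a / 2 ∧ |w.im| < a / 2} =
      Complex.measurableEquivRealProd ⁻¹' (Set.Ioo (-(a / 2)) (a / 2) ×ˢ Set.Ioo (-(a / 2)) (a / 2)) := by
    ext w
    simp [abs_lt, Complex.measurableEquivRealProd_apply]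
  rw [h, Complex.volume_preserving_equiv_real_prod.measure_preimage
    (measurableSet_Ioo.prod measurableSet_Ioo).nullMeasurableSet, Measure.volume_eq_prod,
    Measure.prod_prod, Real.volume_Ioo, ← ENNReal.ofReal_mul (by linarith)]
  congr 1
  ring

theorem volume_openSquare (c : ℂ) (a : ℝ) (ha : 0 ≤ a) (u : Circle) :
    volume (openSquare c a u) = ENNReal.ofReal (a ^ 2) := by
  rw [openSquare, ← volume_openBox a ha]
  exact (((rotation u⁻¹).measurePreserving).comp
    (measurePreserving_sub_right volume c)).measure_preimage
      (isOpen_openBox a).measurableSet.nullMeasurableSet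

/-! ### Areas of discs -/

theorem volume_real_closedBall (z : ℂ) {ρ : ℝ} (hρ : 0 ≤ ρ) :
    volume.real (Metric.closedBall z ρ) = Real.pi * ρ ^ 2 := by
  rw [measureReal_def, Complex.volume_closedBall]
  simp [hρ, mul_comm]

theorem volume_real_ball (z : ℂ) {ρ : ℝ} (hρ : 0 ≤ ρ) :
    volume.real (Metric.ball z ρ) = Real.pi * ρ ^ 2 := by
  rw [measureReal_def, Complex.volume_ball]
  simp [hρ, mul_comm]

/-! ### Scales -/

namespace IsScaleSequence

variable {r : ℕ → ℝ}

theorem sNext_nonneg (r : ℕ → ℝ) (n : ℕ) : 0 ≤ sNext r n := by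
  unfold sNext; positivity

theorem sNext_lt (hr : IsScaleSequence r) (n : ℕ) : sNext r n < 2 / 5 := by
  have h : √(r (n + 1) / r n) < 1 / 10 := by
    rw [Real.sqrt_lt' (by norm_num), div_lt_iff₀ (hr.pos n)]
    linarith [hr.lt n]
  unfold sNext; linarith

theorem tendsto_sNext (hr : IsScaleSequence r) : Tendsto (sNext r) atTop (𝓝 0) := by
  have h := hr.summable.tendsto_atTop_zero.pow 2
  simpa [Real.sq_sqrt (sNext_nonneg r _)] using h

/-- The side length of the squares of the construction. -/
theorem ten_mul_le_side (hr : IsScaleSequence r) (n : ℕ) :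
    10 * r (n + 1) ≤ √(Real.pi * r (n + 1) * r n) := by
  have h1 := hr.pos (n + 1)
  have h2 := hr.lt n
  apply Real.le_sqrt_of_sq_le
  have : 3 * r (n + 1) * (100 * r (n + 1)) ≤ Real.pi * r (n + 1) * r n := by
    have := Real.pi_gt_three
    gcongr
    linarith
  nlinarith

/-- Turns every error proportional to the side of a square into a multiple of `sNext r n`. -/
theorem side_le (hr : IsScaleSequence r) (n : ℕ) :
    √(Real.pi * r (n + 1) * r n) ≤ sNext r n * r n / 2 := by
  have h1 := hr.pos (n + 1)
  have h2 := hr.pos n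
  refine Real.sqrt_le_iff.2 ⟨by have := sNext_nonneg r n; positivity, ?_⟩
  have h3 : sNext r n ^ 2 = 16 * (r (n + 1) / r n) := by
    unfold sNext
    rw [mul_pow, Real.sq_sqrt (by positivity)]; norm_num
  have h4 : (sNext r n * r n / 2) ^ 2 = 4 * r (n + 1) * r n := by
    rw [div_pow, mul_pow, h3]; field_simp; norm_num
  rw [h4]
  have := Real.pi_le_four
  gcongr

theorem bigRadius_pos (hr : IsScaleSequence r) (n : ℕ) : 0 < (1 + sNext r n) * r n := by
  have := hr.pos n
  have := sNext_nonneg r n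
  positivity

theorem bigRadius_lt (hr : IsScaleSequence r) (n : ℕ) :
    (1 + sNext r n) * r n < 7 / 5 * r n := by
  have := hr.pos n
  have := hr.sNext_lt n
  gcongr
  linarith

theorem volume_openSquare (hr : IsScaleSequence r) (n : ℕ) (c : ℂ) (u : Circle) :
    volume.real (openSquare c √(Real.pi * r (n + 1) * r n) u) = Real.pi * r (n + 1) * r n := by
  have h1 := hr.pos (n + 1)
  have h2 := hr.pos n
  rw [measureReal_def, SparseCantor.volume_openSquare _ _ (by positivity),
    Real.sq_sqrt (by positivity), ENNReal.toReal_ofReal (by positivity)]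

/-- Half the side is at least `5 * r (n + 1)`, while the enlarged radius is below `7/5 * r (n + 1)`.
-/
theorem bigDisc_subset_openSquare (hr : IsScaleSequence r) (n : ℕ) (c : ℂ) (u : Circle) :
    bigDisc r (n + 1) c ⊆ openSquare c √(Real.pi * r (n + 1) * r n) u := by
  refine Set.Subset.trans (Metric.closedBall_subset_ball ?_) (ball_subset_openSquare _ _ _)
  have := hr.ten_mul_le_side n
  have := hr.bigRadius_lt (n + 1)
  have := hr.pos (n + 1)
  linarith

end IsScaleSequence

theorem center_mem_bigDisc {r : ℕ → ℝ} (hr : IsScaleSequence r) (n : ℕ) (c : ℂ) :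
    c ∈ bigDisc r n c :=
  Metric.mem_closedBall_self (hr.bigRadius_pos n).le

theorem measurableSet_bigDisc {r : ℕ → ℝ} (n : ℕ) (c : ℂ) : MeasurableSet (bigDisc r n c) :=
  measurableSet_closedBall

/-! ### Geometry of the construction -/

namespace Construction

variable {r : ℕ → ℝ} (C : Construction r)

/-- The squares attached to a generation-`n` disc, in the form of disjoint open squares. -/
theorem exists_openSquares {n : ℕ} {w : ℂ} (hw : w ∈ C.centers n) :
    ∃ u : ℂ → Circle,
      (∀ c ∈ C.children n w, openSquare c √(Real.pi * r (n + 1) * r n) (u c) ⊆ bigDisc r n w) ∧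
      (C.children n w : Set ℂ).PairwiseDisjoint
        fun c => openSquare c √(Real.pi * r (n + 1) * r n) (u c) := by
  obtain ⟨-, u, h1, h2⟩ := C.packing n w hw
  refine ⟨u, fun c hc => ?_, fun c hc c' hc' hne => ?_⟩
  · rw [bigDisc, sNext, mul_comm (1 + _) (r n)]
    exact ((openSquare_subset_interior_square _ _ _).trans interior_subset).trans (h1 c hc)
  · exact (h2 c hc c' hc' hne).mono (openSquare_subset_interior_square _ _ _)
      (openSquare_subset_interior_square _ _ _)

theorem card_children {n : ℕ} {w : ℂ} (hw : w ∈ C.centers n) :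
    ((C.children n w).card : ℝ) = r n / r (n + 1) :=
  (C.packing n w hw).1

theorem mem_centers_succ {n : ℕ} {c : ℂ} :
    c ∈ C.centers (n + 1) ↔ ∃ w ∈ C.centers n, c ∈ C.children n w := by
  rw [C.centers_succ, Finset.mem_biUnion]

theorem bigDisc_child_subset (hr : IsScaleSequence r) {n : ℕ} {w c : ℂ} (hw : w ∈ C.centers n)
    (hc : c ∈ C.children n w) : bigDisc r (n + 1) c ⊆ bigDisc r n w := by
  obtain ⟨u, h1, -⟩ := C.exists_openSquares hw
  exact (hr.bigDisc_subset_openSquare n c (u c)).trans (h1 c hc)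

theorem dist_children (hr : IsScaleSequence r) {n : ℕ} {w c c' : ℂ} (hw : w ∈ C.centers n)
    (hc : c ∈ C.children n w) (hc' : c' ∈ C.children n w) (hne : c ≠ c') :
    4 * r (n + 1) ≤ dist c c' := by
  obtain ⟨u, -, h2⟩ := C.exists_openSquares hw
  by_contra! h
  refine Set.disjoint_left.1 (h2 hc hc' hne) (?_ : c' ∈ _)
    (hr.bigDisc_subset_openSquare n c' (u c') (center_mem_bigDisc hr _ _))
  refine ball_subset_openSquare _ _ _ ?_
  rw [Metric.mem_ball, dist_comm]
  have := hr.ten_mul_le_side n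
  have := hr.pos (n + 1)
  linarith

theorem dist_centers (hr : IsScaleSequence r) {n : ℕ} {c c' : ℂ}
    (hc : c ∈ C.centers n) (hc' : c' ∈ C.centers n) (hne : c ≠ c') :
    4 * r n ≤ dist c c' := by
  induction n generalizing c c' with
  | zero =>
    rw [C.centers_zero, Finset.mem_singleton] at hc hc'
    exact absurd (hc.trans hc'.symm) hne
  | succ n ih =>
    obtain ⟨w, hw, hcw⟩ := C.mem_centers_succ.1 hc
    obtain ⟨w', hw', hcw'⟩ := C.mem_centers_succ.1 hc'
    by_cases h : w = w'
    · subst h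
      exact C.dist_children hr hw hcw hcw' hne
    -- Parents are `4 * r n` apart and each child centre lies within `7/5 * r n` of its parent's;
    -- the remaining `6/5 * r n` exceeds `4 * r (n + 1)`.
    · have h1 := ih hw hw' h
      have h2 : dist c w ≤ _ := C.bigDisc_child_subset hr hw hcw (center_mem_bigDisc hr _ _)
      have h3 : dist c' w' ≤ _ := C.bigDisc_child_subset hr hw' hcw' (center_mem_bigDisc hr _ _)
      have h4 := dist_triangle4 w c c' w'
      rw [dist_comm w c] at h4
      have := hr.bigRadius_lt n
      have := hr.lt n
      have := hr.pos n
      linarith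

theorem pairwiseDisjoint_bigDisc (hr : IsScaleSequence r) (n : ℕ) :
    (C.centers n : Set ℂ).PairwiseDisjoint (bigDisc r n) := by
  intro c hc c' hc' hne
  refine Metric.closedBall_disjoint_closedBall ?_
  have := C.dist_centers hr hc hc' hne
  have := hr.bigRadius_lt n
  have := hr.pos n
  linarith

theorem eq_of_mem_bigDisc (hr : IsScaleSequence r) {n : ℕ} {c c' z : ℂ}
    (hc : c ∈ C.centers n) (hc' : c' ∈ C.centers n) (hz : z ∈ bigDisc r n c)
    (hz' : z ∈ bigDisc r n c') : c = c' := by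
  by_contra h
  exact Set.disjoint_left.1 (C.pairwiseDisjoint_bigDisc hr n hc hc' h) hz hz'

theorem pairwiseDisjoint_children (hr : IsScaleSequence r) (n : ℕ) :
    (C.centers n : Set ℂ).PairwiseDisjoint (C.children n) := by
  intro w hw w' hw' hne
  refine Finset.disjoint_left.2 fun c hc hc' => hne ?_
  exact C.eq_of_mem_bigDisc hr hw hw'
    (C.bigDisc_child_subset hr hw hc (center_mem_bigDisc hr _ _))
    (C.bigDisc_child_subset hr hw' hc' (center_mem_bigDisc hr _ _))

theorem card_biUnion_children (hr : IsScaleSequence r) {n : ℕ} {T : Finset ℂ}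
    (hT : T ⊆ C.centers n) :
    ((T.biUnion (C.children n)).card : ℝ) * r (n + 1) = T.card * r n := by
  have h := (hr.pos (n + 1)).ne'
  rw [Finset.card_biUnion fun w hw w' hw' hne =>
    C.pairwiseDisjoint_children hr n (hT hw) (hT hw') hne, Nat.cast_sum,
    Finset.sum_congr rfl fun w hw => C.card_children (hT hw)]
  simp
  field_simp

theorem card_centers (hr : IsScaleSequence r) (n : ℕ) : ((C.centers n).card : ℝ) * r n = 1 := by
  induction n with
  | zero => simp [C.centers_zero, hr.zero]
  | succ n ih => rw [C.centers_succ, C.card_biUnion_children hr subset_rfl, ih]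

/-- The generation-`(n + k)` descendants of a generation-`n` centre. -/
theorem exists_descendants (hr : IsScaleSequence r) {n : ℕ} {w : ℂ} (hw : w ∈ C.centers n)
    (k : ℕ) : ∃ D ⊆ C.centers (n + k), (D.card : ℝ) * r (n + k) = r n ∧
      ∀ c ∈ D, bigDisc r (n + k) c ⊆ bigDisc r n w := by
  induction k with
  | zero => exact ⟨{w}, by simpa using hw, by simp, by simp⟩
  | succ k ih =>
    obtain ⟨D, hD, hcard, hsub⟩ := ih
    refine ⟨D.biUnion (C.children (n + k)), ?_, ?_, ?_⟩
    · rw [← add_assoc, C.centers_succ]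
      exact Finset.biUnion_subset_biUnion_of_subset_left _ hD
    · rw [← add_assoc, C.card_biUnion_children hr hD, hcard]
    · intro c hc
      obtain ⟨v, hv, hcv⟩ := Finset.mem_biUnion.1 hc
      exact (C.bigDisc_child_subset hr (hD hv) hcv).trans (hsub v hv)

/-! ### Masses -/

theorem m₂_closedBall (z : ℂ) {ρ : ℝ} (hρ : 0 ≤ ρ) :
    m₂ (Metric.closedBall z ρ) = ENNReal.ofReal (ρ ^ 2) := by
  rw [m₂, Measure.smul_apply, Complex.volume_closedBall, smul_eq_mul, ← ENNReal.ofReal_pow hρ,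
    ← ENNReal.ofReal_coe_nnreal, ← ENNReal.ofReal_mul (by positivity),
    ← ENNReal.ofReal_mul (by positivity), NNReal.coe_real_pi]
  congr 1
  field_simp

theorem approxMeasure_apply (n : ℕ) (A : Set ℂ) :
    C.approxMeasure n A = ∑ z ∈ C.centers n,
      ENNReal.ofReal (1 / r n) * m₂.restrict (Metric.closedBall z (r n)) A := by
  simp [approxMeasure, Measure.finsetSum_apply]

theorem approxMeasure_univ (hr : IsScaleSequence r) (n : ℕ) : C.approxMeasure n Set.univ = 1 := by
  have h := hr.pos n
  rw [approxMeasure_apply, Finset.sum_congr rfl fun z _ => by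
    rw [Measure.restrict_apply_univ, m₂_closedBall z h.le, ← ENNReal.ofReal_mul (by positivity)],
    Finset.sum_const, nsmul_eq_mul, ← ENNReal.ofReal_natCast, ← ENNReal.ofReal_mul (by positivity),
    ← ENNReal.ofReal_one]
  congr 1
  refine Eq.trans ?_ (C.card_centers hr n)
  field_simp

theorem le_approxMeasure_bigDisc (hr : IsScaleSequence r) {n : ℕ} {w : ℂ} (hw : w ∈ C.centers n)
    {m : ℕ} (hm : n ≤ m) : ENNReal.ofReal (r n) ≤ C.approxMeasure m (bigDisc r n w) := by
  obtain ⟨k, rfl⟩ := Nat.exists_eq_add_of_le hm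
  obtain ⟨D, hD, hcard, hsub⟩ := C.exists_descendants hr hw k
  have h := hr.pos (n + k)
  have hball : ∀ z ∈ D, Metric.closedBall z (r (n + k)) ⊆ bigDisc r n w := fun z hz =>
    (Metric.closedBall_subset_closedBall (by
      have := IsScaleSequence.sNext_nonneg r (n + k)
      nlinarith)).trans (hsub z hz)
  calc ENNReal.ofReal (r n) = ∑ z ∈ D, ENNReal.ofReal (1 / r (n + k)) *
        m₂.restrict (Metric.closedBall z (r (n + k))) (bigDisc r n w) := by
        rw [Finset.sum_congr rfl fun z hz => by
          rw [Measure.restrict_apply (measurableSet_bigDisc _ _),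
            Set.inter_eq_right.2 (hball z hz), m₂_closedBall z h.le,
            ← ENNReal.ofReal_mul (by positivity)],
          Finset.sum_const, nsmul_eq_mul, ← ENNReal.ofReal_natCast,
          ← ENNReal.ofReal_mul (by positivity), ← hcard]
        congr 1
        field_simp
    _ ≤ _ := by
        rw [approxMeasure_apply]
        exact Finset.sum_le_sum_of_subset hD

variable {C} {μ : FiniteMeasure ℂ}

theorem IsWeakSubseqLimit.measure_univ (hr : IsScaleSequence r) (hμ : C.IsWeakSubseqLimit μ) :
    (μ : Measure ℂ) Set.univ = 1 := by
  obtain ⟨φ, -, hlim⟩ := hμ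
  have h := (FiniteMeasure.continuous_mass.tendsto μ).comp hlim
  have h1 : (fun ν : FiniteMeasure ℂ => ν.mass) ∘ (fun k => C.approx (φ k)) = fun _ => 1 := by
    funext k
    refine ENNReal.coe_injective ?_
    simp only [Function.comp_apply, FiniteMeasure.ennreal_mass]
    exact C.approxMeasure_univ hr _
  rw [h1] at h
  rw [← FiniteMeasure.ennreal_mass, ← tendsto_nhds_unique tendsto_const_nhds h]
  simp

/-- On closed sets weak limits can only gain mass, so the lower bound for the approximating measures
survives. -/
theorem IsWeakSubseqLimit.le_measure_bigDisc (hr : IsScaleSequence r) (hμ : C.IsWeakSubseqLimit μ)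
    {n : ℕ} {w : ℂ} (hw : w ∈ C.centers n) :
    ENNReal.ofReal (r n) ≤ (μ : Measure ℂ) (bigDisc r n w) := by
  obtain ⟨φ, hφ, hlim⟩ := hμ
  refine le_trans ?_ (FiniteMeasure.limsup_measure_closed_le_of_tendsto hlim
    (Metric.isClosed_closedBall : IsClosed (bigDisc r n w)))
  refine le_limsup_of_frequently_le (Eventually.frequently ?_)
  filter_upwards [eventually_ge_atTop n] with k hk
  exact C.le_approxMeasure_bigDisc hr hw (hk.trans (hφ.id_le k))

theorem IsWeakSubseqLimit.measureReal_univ (hr : IsScaleSequence r) (hμ : C.IsWeakSubseqLimit μ) :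
    (μ : Measure ℂ).real Set.univ = 1 := by
  rw [measureReal_def, hμ.measure_univ hr, ENNReal.toReal_one]

theorem IsWeakSubseqLimit.sum_measureReal_bigDisc_le (hr : IsScaleSequence r)
    (hμ : C.IsWeakSubseqLimit μ) (n : ℕ) :
    ∑ w ∈ C.centers n, (μ : Measure ℂ).real (bigDisc r n w) ≤ 1 := by
  rw [← measureReal_biUnion_finset (C.pairwiseDisjoint_bigDisc hr n)
    (fun w _ => measurableSet_bigDisc n w), ← hμ.measureReal_univ hr]
  exact measureReal_mono (Set.subset_univ _)

/-- The lower bounds `r n` already add up to the total mass 1, so none of them can be strict. -/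
theorem IsWeakSubseqLimit.measureReal_bigDisc (hr : IsScaleSequence r)
    (hμ : C.IsWeakSubseqLimit μ) {n : ℕ} {w : ℂ} (hw : w ∈ C.centers n) :
    (μ : Measure ℂ).real (bigDisc r n w) = r n := by
  have hle : ∀ v ∈ C.centers n, r n ≤ (μ : Measure ℂ).real (bigDisc r n v) := fun v hv =>
    (ENNReal.ofReal_le_iff_le_toReal (measure_ne_top _ _)).1 (hμ.le_measure_bigDisc hr hv)
  have hsum : ∑ _v ∈ C.centers n, r n = ∑ v ∈ C.centers n, (μ : Measure ℂ).real (bigDisc r n v) := by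
    refine le_antisymm (Finset.sum_le_sum hle) ?_
    rw [Finset.sum_const, nsmul_eq_mul, C.card_centers hr n]
    exact hμ.sum_measureReal_bigDisc_le hr n
  exact ((Finset.sum_eq_sum_iff_of_le hle).1 hsum w hw).symm

theorem IsWeakSubseqLimit.ae_mem_bigDisc (hr : IsScaleSequence r)
    (hμ : C.IsWeakSubseqLimit μ) (n : ℕ) :
    ∀ᵐ z ∂(μ : Measure ℂ), ∃ w ∈ C.centers n, z ∈ bigDisc r n w := by
  have hm : MeasurableSet (⋃ w ∈ C.centers n, bigDisc r n w) :=
    Finset.measurableSet_biUnion _ fun w _ => measurableSet_bigDisc n w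
  have h : (μ : Measure ℂ).real (⋃ w ∈ C.centers n, bigDisc r n w)ᶜ = 0 := by
    rw [measureReal_compl hm, hμ.measureReal_univ hr,
      measureReal_biUnion_finset (C.pairwiseDisjoint_bigDisc hr n)
        (fun w _ => measurableSet_bigDisc n w),
      Finset.sum_congr rfl fun w hw => hμ.measureReal_bigDisc hr hw, Finset.sum_const,
      nsmul_eq_mul, C.card_centers hr n, sub_self]
  rw [measureReal_eq_zero_iff] at h
  filter_upwards [measure_eq_zero_iff_ae_notMem.1 h] with z hz
  simpa using hz

end Construction

/-! ### The kernel -/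

theorem norm_K (z : ℂ) : ‖K z‖ = ‖z‖⁻¹ := by
  rw [K, norm_div, norm_pow, RCLike.norm_conj]
  by_cases h : ‖z‖ = 0
  · simp [h]
  · field_simp

theorem measurable_K : Measurable K := by
  unfold K
  exact (Complex.continuous_conj.measurable).div (by fun_prop)

theorem K_mul (a b : ℂ) : K (a * b) = K a * K b := by
  simp only [K, map_mul, mul_pow]
  exact mul_div_mul_comm _ _ _ _

/-- Over the common denominator the numerator is `x̄ (y² - x²) + conj (x - y) x²`, and each term
contains a factor `x - y`. -/
theorem norm_K_sub_le {x y : ℂ} (hx : x ≠ 0) (hy : y ≠ 0) :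
    ‖K x - K y‖ ≤ ‖x - y‖ * (2 / ‖y‖ ^ 2 + 1 / (‖x‖ * ‖y‖)) := by
  have h : K x - K y = ((starRingEnd ℂ) x * (-(x - y) * (x + y)) +
      (starRingEnd ℂ) (x - y) * x ^ 2) / (x ^ 2 * y ^ 2) := by
    simp only [K, map_sub]
    field_simp
    ring
  have hx' : 0 < ‖x‖ := norm_pos_iff.2 hx
  have hy' : 0 < ‖y‖ := norm_pos_iff.2 hy
  rw [h, norm_div, norm_mul, norm_pow, norm_pow, div_le_iff₀ (by positivity)]
  calc _ ≤ ‖x‖ * (‖x - y‖ * (‖x‖ + ‖y‖)) + ‖x - y‖ * ‖x‖ ^ 2 := by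
        refine (norm_add_le _ _).trans ?_
        rw [norm_mul, norm_mul, norm_mul, norm_neg, RCLike.norm_conj, RCLike.norm_conj, norm_pow]
        gcongr
        exact norm_add_le _ _
    _ = _ := by field_simp; ring

/-- On the unit circle conjugation is inversion, so `K (t e^{iθ}) = e^{-3iθ} / t`. -/
theorem K_polar {t : ℝ} (ht : 0 < t) (θ : ℝ) :
    (K (t * (Real.cos θ + Real.sin θ * Complex.I))).re = Real.cos (3 * θ) / t := by
  have h : K (t * (Real.cos θ + Real.sin θ * Complex.I)) =
      (t⁻¹ : ℝ) * (Real.cos θ - Real.sin θ * Complex.I) ^ 3 := by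
    have h1 : ((Real.cos θ : ℂ) + Real.sin θ * Complex.I) *
        (Real.cos θ - Real.sin θ * Complex.I) = 1 := by
      have := Complex.cos_sq_add_sin_sq θ
      push_cast
      linear_combination this - Complex.sin θ ^ 2 * Complex.I_sq
    have h0 : ((Real.cos θ : ℂ) + Real.sin θ * Complex.I) ≠ 0 := left_ne_zero_of_mul_eq_one h1
    have ht' : (t : ℂ) ≠ 0 := by exact_mod_cast ht.ne'
    have h2 : (starRingEnd ℂ) ((t : ℂ) * (Real.cos θ + Real.sin θ * Complex.I)) =
        t * (Real.cos θ - Real.sin θ * Complex.I) := by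
      simp only [map_mul, map_add, Complex.conj_ofReal, Complex.conj_I]
      ring
    rw [K, h2, div_eq_iff (by positivity)]
    push_cast at h1 ⊢
    field_simp
    linear_combination (Complex.cos θ - Complex.sin θ * Complex.I) *
      (-1 - (Complex.cos θ + Complex.sin θ * Complex.I) * (Complex.cos θ - Complex.sin θ * Complex.I)) * h1
  have h3 : ((Real.cos θ : ℂ) - Real.sin θ * Complex.I) ^ 3 =
      Real.cos (3 * θ) - Real.sin (3 * θ) * Complex.I := by
    rw [Real.cos_three_mul, Real.sin_three_mul]
    have := Complex.cos_sq_add_sin_sq θ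
    push_cast
    linear_combination (-3 * Complex.cos θ - 3 * Complex.I * Complex.sin θ) * this +
      (3 * Complex.cos θ * Complex.sin θ ^ 2 - Complex.sin θ ^ 3 * Complex.I) * Complex.I_sq
  rw [h, h3, Complex.re_ofReal_mul]
  simp only [Complex.sub_re, Complex.ofReal_re, Complex.re_ofReal_mul, Complex.I_re, mul_zero,
    sub_zero, div_eq_inv_mul]

/-- The part of the annulus `1/2 < |η| ≤ 1` inside a unit disc whose boundary contains `0`. -/
def lens : Set ℂ := annulus 0 1 ∩ Metric.closedBall 1 1

theorem mem_lens_polar {t θ : ℝ} (ht : 0 < t) :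
    (t * (Real.cos θ + Real.sin θ * Complex.I) : ℂ) ∈ lens ↔
      t ∈ Set.Ioc (1 / 2 : ℝ) 1 ∧ t / 2 ≤ Real.cos θ := by
  have h1 : ‖(t * (Real.cos θ + Real.sin θ * Complex.I) : ℂ)‖ = t := by
    rw [norm_mul, Complex.norm_real, Real.norm_of_nonneg ht.le]
    push_cast
    rw [Complex.norm_cos_add_sin_mul_I, mul_one]
  have h2 : ‖(t * (Real.cos θ + Real.sin θ * Complex.I) : ℂ) - 1‖ ≤ 1 ↔ t / 2 ≤ Real.cos θ := by
    rw [← sq_le_one_iff₀ (norm_nonneg _), ← Complex.normSq_eq_norm_sq, Complex.normSq_apply]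
    have h := Real.sin_sq_add_cos_sq θ
    simp only [Complex.sub_re, Complex.sub_im, Complex.re_ofReal_mul, Complex.im_ofReal_mul,
      Complex.add_re, Complex.add_im, Complex.ofReal_re, Complex.ofReal_im, Complex.I_re,
      Complex.I_im, Complex.one_re, Complex.one_im]
    have h' : (t * (Real.cos θ + (Real.sin θ * 0 - 0 * 1)) - 1) *
        (t * (Real.cos θ + (Real.sin θ * 0 - 0 * 1)) - 1) +
        (t * (0 + (Real.sin θ * 1 + 0 * 0)) - 0) * (t * (0 + (Real.sin θ * 1 + 0 * 0)) - 0) =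
        1 + t * (t - 2 * Real.cos θ) := by
      linear_combination t ^ 2 * h
    simp only [mul_zero, mul_one, sub_zero, add_zero, zero_add] at h' ⊢
    rw [h']
    constructor
    · intro h3
      by_contra! h4
      nlinarith
    · intro h3
      nlinarith
  simp only [lens, annulus, Set.mem_inter_iff, Set.mem_sdiff, mem_closedBall_iff_norm, sub_zero, h1,
    h2, Set.mem_Ioc, not_le]
  tauto

/-- The condition on `θ` is `|θ| ≤ a` with `cos a = t / 2`; the integral is `(2/3) sin 3a`, and `sin
3a = sin a (4 cos² a - 1) = -(1 - t²) sin a`. -/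
theorem integral_cos_three_mul {t : ℝ} (ht : t ∈ Set.Ioc (1 / 2 : ℝ) 1) :
    ∫ θ in Set.Ioo (-Real.pi) Real.pi, {θ | t / 2 ≤ Real.cos θ}.indicator
      (fun θ => Real.cos (3 * θ)) θ = -(2 / 3 * ((1 - t ^ 2) * √(1 - (t / 2) ^ 2))) := by
  set a := Real.arccos (t / 2) with ha
  have hcos : Real.cos a = t / 2 := Real.cos_arccos (by linarith [ht.1]) (by linarith [ht.2])
  have hsin : Real.sin a = √(1 - (t / 2) ^ 2) := Real.sin_arccos _
  have ha0 : 0 ≤ a := Real.arccos_nonneg _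
  have hapi : a < Real.pi := by
    have : a ≤ Real.pi / 2 := Real.arccos_le_pi_div_two.2 (by linarith [ht.1])
    linarith [Real.pi_pos]
  have hset : Set.Ioo (-Real.pi) Real.pi ∩ {θ | t / 2 ≤ Real.cos θ} = Set.Icc (-a) a := by
    ext θ
    simp only [Set.mem_inter_iff, Set.mem_Ioo, Set.mem_ofPred_eq, Set.mem_Icc]
    rw [← abs_lt, ← abs_le, ← Real.cos_abs θ, ← hcos]
    constructor
    · rintro ⟨h1, h2⟩
      by_contra! h3
      exact absurd (Real.cos_lt_cos_of_nonneg_of_le_pi ha0 h1.le h3) (not_lt.2 h2)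
    · intro h
      exact ⟨h.trans_lt hapi, Real.cos_le_cos_of_nonneg_of_le_pi (abs_nonneg _) hapi.le h⟩
  rw [setIntegral_indicator (measurableSet_le measurable_const Real.measurable_cos), hset,
    integral_Icc_eq_integral_Ioc, ← intervalIntegral.integral_of_le (by linarith),
    intervalIntegral.integral_comp_mul_left _ (by norm_num), integral_cos, mul_neg, Real.sin_neg,
    Real.sin_three_mul, hsin]
  have h4 : √(1 - (t / 2) ^ 2) ^ 2 = 1 - (t / 2) ^ 2 :=
    Real.sq_sqrt (by nlinarith [ht.1, ht.2])
  simp only [smul_eq_mul]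
  linear_combination (-8 / 3 * √(1 - (t / 2) ^ 2)) * h4

theorem measurableSet_annulus (z : ℂ) (ρ : ℝ) : MeasurableSet (annulus z ρ) :=
  measurableSet_closedBall.diff measurableSet_closedBall

theorem measurableSet_lens : MeasurableSet lens :=
  (measurableSet_annulus _ _).inter measurableSet_closedBall

theorem integrableOn_K_lens : IntegrableOn K lens := by
  refine Measure.integrableOn_of_bounded (M := 2) ?_ measurable_K.aestronglyMeasurable ?_
  · exact ((measure_mono Set.inter_subset_right).trans_lt measure_closedBall_lt_top).ne
  · filter_upwards [ae_restrict_mem measurableSet_lens] with x hx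
    have h1 := hx.1.2
    rw [mem_closedBall_iff_norm, sub_zero, not_le] at h1
    rw [norm_K]
    refine inv_le_of_inv_le₀ (by norm_num) ?_
    linarith

theorem re_integral_K_lens : (∫ η in lens, K η).re < 0 := by
  have h0 : (∫ η in lens, K η).re = ∫ η, lens.indicator (fun η => (K η).re) η := by
    rw [integral_indicator measurableSet_lens]
    exact (Complex.reCLM.integral_comp_comm integrableOn_K_lens).symm
  let G : ℝ × ℝ → ℝ := fun p =>
    {θ | p.1 / 2 ≤ Real.cos θ}.indicator (fun θ => Real.cos (3 * θ)) p.2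
  have hG : Measurable G := by
    have : G = {p : ℝ × ℝ | p.1 / 2 ≤ Real.cos p.2}.indicator fun p => Real.cos (3 * p.2) := by
      funext p
      simp [G, Set.indicator]
    rw [this]
    exact Measurable.indicator (by fun_prop) (measurableSet_le (by fun_prop) (by fun_prop))
  -- The Jacobian `t` cancels the factor `1 / t` of the kernel.
  have h1 : ∀ p ∈ polarCoord.target,
      p.1 • lens.indicator (fun η => (K η).re) (Complex.polarCoord.symm p) =
        (Set.Ioc (1 / 2 : ℝ) 1 ×ˢ (Set.univ : Set ℝ)).indicator G p := by
    rintro ⟨t, θ⟩ ⟨ht, -⟩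
    have ht : 0 < t := ht
    rw [Complex.polarCoord_symm_apply]
    simp only [G, Set.indicator, mem_lens_polar ht, Set.mem_prod, Set.mem_univ, and_true,
      Set.mem_ofPred_eq, smul_eq_mul]
    by_cases h2 : t ∈ Set.Ioc (1 / 2 : ℝ) 1
    · by_cases h3 : t / 2 ≤ Real.cos θ
      · rw [if_pos ⟨h2, h3⟩, if_pos h2, if_pos h3, K_polar ht]
        field_simp
      · rw [if_neg (fun h => h3 h.2), if_pos h2, if_neg h3, mul_zero]
    · rw [if_neg (fun h => h2 h.1), if_neg h2, mul_zero]
  have h2 : polarCoord.target ∩ (Set.Ioc (1 / 2 : ℝ) 1 ×ˢ (Set.univ : Set ℝ)) =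
      Set.Ioc (1 / 2 : ℝ) 1 ×ˢ Set.Ioo (-Real.pi) Real.pi := by
    ext p
    simp only [polarCoord_target, Set.mem_inter_iff, Set.mem_prod, Set.mem_Ioi, Set.mem_univ,
      and_true, Set.mem_Ioc]
    constructor
    · rintro ⟨⟨-, h⟩, h'⟩
      exact ⟨h', h⟩
    · rintro ⟨h', h⟩
      exact ⟨⟨by linarith [h'.1], h⟩, h'⟩
  have hint : IntegrableOn G (Set.Ioc (1 / 2 : ℝ) 1 ×ˢ Set.Ioo (-Real.pi) Real.pi)
      ((volume : Measure ℝ).prod volume) := by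
    refine Measure.integrableOn_of_bounded (M := 1) ?_ hG.aestronglyMeasurable
      (ae_of_all _ fun p => ?_)
    · rw [Measure.prod_prod, Real.volume_Ioc, Real.volume_Ioo]
      exact ENNReal.mul_ne_top ENNReal.ofReal_ne_top ENNReal.ofReal_ne_top
    · simp only [G, Set.indicator]
      split_ifs
      · exact Real.abs_cos_le_one _
      · simp
  rw [h0, ← Complex.integral_comp_polarCoord_symm,
    setIntegral_congr_fun polarCoord.open_target.measurableSet h1,
    setIntegral_indicator (measurableSet_Ioc.prod MeasurableSet.univ), h2, Measure.volume_eq_prod,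
    setIntegral_prod _ hint, setIntegral_congr_fun measurableSet_Ioc
      (fun t ht => integral_cos_three_mul ht), integral_neg, neg_lt_zero,
    ← intervalIntegral.integral_of_le (by norm_num)]
  refine intervalIntegral.intervalIntegral_pos_of_pos_on
    (Continuous.intervalIntegrable (by fun_prop) _ _) (fun t ht => ?_) (by norm_num)
  have h3 : 0 < 1 - t ^ 2 := by nlinarith [ht.1, ht.2]
  have h4 : 0 < 1 - (t / 2) ^ 2 := by nlinarith [ht.1, ht.2]
  have := Real.sqrt_pos.2 h4
  positivity

theorem integral_K_lens_ne_zero : ∫ η in lens, K η ≠ 0 := fun h => by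
  have := re_integral_K_lens
  simp [h] at this

/-! ### Rings and spheres -/

/-- The closed ring about the circle of centre `z` and radius `ρ`, of half-width `δ`. -/
def closedRing (z : ℂ) (ρ δ : ℝ) : Set ℂ := {ξ : ℂ | |‖ξ - z‖ - ρ| ≤ δ}

theorem closedRing_subset_closedBall (z : ℂ) (ρ δ : ℝ) : closedRing z ρ δ ⊆ Metric.closedBall z (ρ + δ) := by
  intro ξ hξ
  have h : |‖ξ - z‖ - ρ| ≤ δ := hξ
  have := (abs_le.1 h).2
  rw [mem_closedBall_iff_norm]
  linarith

theorem volume_closedRing_ne_top (z : ℂ) (ρ δ : ℝ) : volume (closedRing z ρ δ) ≠ ⊤ :=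
  ((measure_mono (closedRing_subset_closedBall z ρ δ)).trans_lt measure_closedBall_lt_top).ne

theorem measurableSet_closedRing (z : ℂ) (ρ δ : ℝ) : MeasurableSet (closedRing z ρ δ) :=
  measurableSet_le (by fun_prop) measurable_const

theorem volume_real_closedRing_le (z : ℂ) {ρ δ : ℝ} (h0 : 0 ≤ δ) (h : δ ≤ ρ) :
    volume.real (closedRing z ρ δ) ≤ 4 * Real.pi * ρ * δ := by
  have hsub : closedRing z ρ δ ⊆ Metric.closedBall z (ρ + δ) \ Metric.ball z (ρ - δ) := by
    intro ξ hξ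
    refine ⟨closedRing_subset_closedBall z ρ δ hξ, ?_⟩
    have h1 : |‖ξ - z‖ - ρ| ≤ δ := hξ
    have := (abs_le.1 h1).1
    rw [mem_ball_iff_norm]
    linarith
  refine (measureReal_mono hsub
    ((measure_mono Set.sdiff_subset).trans_lt measure_closedBall_lt_top).ne).trans ?_
  rw [measureReal_sdiff (Metric.ball_subset_closedBall.trans
    (Metric.closedBall_subset_closedBall (by linarith))) measurableSet_ball
    measure_closedBall_lt_top.ne,
    volume_real_closedBall z (by linarith), volume_real_ball z (by linarith)]
  exact le_of_eq (by ring)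

theorem infDist_sphere (z w : ℂ) {R : ℝ} (hR : 0 ≤ R) :
    Metric.infDist z (Metric.sphere w R) = |dist z w - R| := by
  refine le_antisymm ?_ ?_
  · obtain ⟨v, hv, hzv⟩ : ∃ v : ℂ, ‖v‖ = 1 ∧ z - w = (‖z - w‖ : ℂ) * v := by
      by_cases h : z - w = 0
      · exact ⟨1, by simp, by simp [h]⟩
      · have h' : (‖z - w‖ : ℂ) ≠ 0 := by simpa using h
        exact ⟨(z - w) / ‖z - w‖, by simp [h], by field_simp⟩
    have hmem : w + R * v ∈ Metric.sphere w R := by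
      simp [hv, abs_of_nonneg hR]
    refine (Metric.infDist_le_dist_of_mem hmem).trans (le_of_eq ?_)
    have h2 : z - (w + R * v) = ((dist z w - R : ℝ) : ℂ) * v := by
      rw [dist_eq_norm]
      push_cast
      linear_combination hzv
    rw [dist_eq_norm z (w + R * v), h2, norm_mul, hv, mul_one, Complex.norm_real, Real.norm_eq_abs]
  · refine (Metric.le_infDist (NormedSpace.sphere_nonempty.2 hR)).2 fun y hy => ?_
    rw [← Metric.mem_sphere.1 hy]
    exact abs_dist_sub_le z y w

theorem infDist_frontier_bigDisc {r : ℕ → ℝ} (hr : IsScaleSequence r) (n : ℕ) (z w : ℂ) :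
    Metric.infDist z (frontier (bigDisc r n w)) = |dist z w - (1 + sNext r n) * r n| := by
  rw [bigDisc, frontier_closedBall _ (hr.bigRadius_pos n).ne',
    infDist_sphere z w (hr.bigRadius_pos n).le]

/-! ### The truncated kernel -/

/-- The kernel `ξ ↦ K (z - ξ)` truncated to the annulus `A(z, ρ)`. -/
noncomputable def annulusKernel (z : ℂ) (ρ : ℝ) : ℂ → ℂ := (annulus z ρ).indicator fun ξ => K (z - ξ)

theorem measurable_annulusKernel (z : ℂ) (ρ : ℝ) : Measurable (annulusKernel z ρ) :=
  (measurable_K.comp (by fun_prop)).indicator (measurableSet_annulus z ρ)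

theorem mem_annulus {z ξ : ℂ} {ρ : ℝ} : ξ ∈ annulus z ρ ↔ ‖ξ - z‖ ≤ ρ ∧ ρ / 2 < ‖ξ - z‖ := by
  rw [annulus, Set.mem_sdiff, mem_closedBall_iff_norm, mem_closedBall_iff_norm, not_le]

theorem norm_annulusKernel_le (z : ℂ) {ρ : ℝ} (hρ : 0 < ρ) (ξ : ℂ) :
    ‖annulusKernel z ρ ξ‖ ≤ 2 / ρ := by
  by_cases h : ξ ∈ annulus z ρ
  · rw [annulusKernel, Set.indicator_of_mem h, norm_K, norm_sub_rev]
    have h1 := (mem_annulus.1 h).2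
    rw [show 2 / ρ = (ρ / 2)⁻¹ by field_simp]
    gcongr
  · rw [annulusKernel, Set.indicator_of_notMem h, norm_zero]
    positivity

theorem integrableOn_annulusKernel (ν : Measure ℂ) (z : ℂ) {ρ : ℝ} (hρ : 0 < ρ) {A : Set ℂ}
    (hA : ν A ≠ ⊤) : IntegrableOn (annulusKernel z ρ) A ν :=
  Measure.integrableOn_of_bounded hA (measurable_annulusKernel z ρ).aestronglyMeasurable
    (ae_of_all _ (norm_annulusKernel_le z hρ))

/-- A move shorter than `a` cannot cross either boundary circle of the annulus, so the indicator
does not change. On the annulus both arguments of `K` exceed `ρ / 2` in norm, whence `12 = 2 * 4 +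
4`. -/
theorem norm_annulusKernel_sub_le {z ξ c : ℂ} {ρ a : ℝ} (hρ : 0 < ρ) (h : ‖ξ - c‖ < a)
    (h1 : c ∉ closedRing z ρ a) (h2 : c ∉ closedRing z (ρ / 2) a) :
    ‖annulusKernel z ρ ξ - annulusKernel z ρ c‖ ≤ 12 * a / ρ ^ 2 := by
  have ha : 0 < a := (norm_nonneg _).trans_lt h
  have h3 : |‖ξ - z‖ - ‖c - z‖| < a := (abs_norm_sub_norm_le _ _).trans_lt (by simpa using h)
  rw [abs_lt] at h3
  have hiff : ξ ∈ annulus z ρ ↔ c ∈ annulus z ρ := by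
    rw [mem_annulus, mem_annulus]
    simp only [closedRing, Set.mem_ofPred_eq, not_le, lt_abs] at h1 h2
    constructor <;> rintro ⟨h4, h5⟩ <;> constructor <;> rcases h1 with h1 | h1 <;>
      rcases h2 with h2 | h2 <;> linarith
  by_cases hc : c ∈ annulus z ρ
  · have hξ := hiff.2 hc
    rw [annulusKernel, Set.indicator_of_mem hc, Set.indicator_of_mem hξ]
    have h4 := (mem_annulus.1 hc).2
    have h5 := (mem_annulus.1 hξ).2
    rw [norm_sub_rev] at h4 h5
    refine (norm_K_sub_le (norm_pos_iff.1 (by linarith)) (norm_pos_iff.1 (by linarith))).trans ?_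
    have h6 : ‖z - ξ - (z - c)‖ ≤ a := by
      rw [sub_sub_sub_cancel_left, norm_sub_rev]
      exact h.le
    calc _ ≤ a * (2 / (ρ / 2) ^ 2 + 1 / (ρ / 2 * (ρ / 2))) := by gcongr
      _ = _ := by field_simp; ring
  · have hξ := mt hiff.1 hc
    rw [annulusKernel, Set.indicator_of_notMem hc, Set.indicator_of_notMem hξ, sub_zero, norm_zero]
    positivity

/-! ### Integrals over nearby sets -/

theorem norm_setIntegral_sub_smul_le {ν : Measure ℂ} {f : ℂ → ℂ} {P : Set ℂ}
    (hν : ν P ≠ ⊤) (hf : IntegrableOn f P ν) {v : ℂ} {ω : ℝ} (h : ∀ ξ ∈ P, ‖f ξ - v‖ ≤ ω) :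
    ‖(∫ ξ in P, f ξ ∂ν) - ν.real P • v‖ ≤ ω * ν.real P := by
  have h1 : (∫ ξ in P, f ξ ∂ν) - ν.real P • v = ∫ ξ in P, (f ξ - v) ∂ν := by
    rw [integral_sub hf (integrableOn_const hν), setIntegral_const]
  rw [h1]
  exact norm_setIntegral_le_of_norm_le_const hν.lt_top h

theorem norm_setIntegral_sub_setIntegral_le {f : ℂ → ℂ} {M : ℝ} (hM : ∀ ξ, ‖f ξ‖ ≤ M)
    {X Y D : Set ℂ} (hX : MeasurableSet X) (hY : MeasurableSet Y) (hD : MeasurableSet D)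
    (hfX : IntegrableOn f X) (hfY : IntegrableOn f Y) (hD' : volume D ≠ ⊤)
    (h : symmDiff X Y ⊆ D) :
    ‖(∫ ξ in X, f ξ) - ∫ ξ in Y, f ξ‖ ≤ M * volume.real D := by
  rw [← integral_indicator hX, ← integral_indicator hY,
    ← integral_sub (hfX.integrable_indicator hX) (hfY.integrable_indicator hY)]
  have hM0 : 0 ≤ M := (norm_nonneg _).trans (hM 0)
  have h1 : ∫ ξ, D.indicator (fun _ => M) ξ = M * volume.real D := by
    rw [integral_indicator hD, setIntegral_const, smul_eq_mul, mul_comm]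
  rw [← h1]
  refine norm_integral_le_of_norm_le ((integrableOn_const hD').integrable_indicator hD)
    (ae_of_all _ fun ξ => ?_)
  have h2 : ξ ∈ symmDiff X Y → ξ ∈ D := fun hξ => h hξ
  rw [Set.mem_symmDiff] at h2
  by_cases hx : ξ ∈ X <;> by_cases hy : ξ ∈ Y <;> by_cases hd : ξ ∈ D <;>
    simp_all

/-! ### The model integral -/

/-- The disc has `z` on its boundary, and `ξ = z - ρ u η` carries the lens onto its part in the
annulus. The Jacobian is `ρ²` and the factor `K (ρ u)` has modulus `1 / ρ`. -/
theorem norm_integral_annulusKernel (z : ℂ) {ρ : ℝ} (hρ : 0 < ρ) (u : Circle) :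
    ‖∫ ξ in Metric.closedBall (z - ρ * u) ρ, annulusKernel z ρ ξ‖ = ρ * ‖∫ η in lens, K η‖ := by
  set B := Metric.closedBall (z - ρ * u : ℂ) ρ with hB
  have h1 : ∀ η : ℂ, B.indicator (annulusKernel z ρ) (z - ρ • rotation u η) =
      lens.indicator (fun η => K (ρ * u) * K η) η := by
    intro η
    have e1 : ‖(z - ρ • rotation u η) - z‖ = ρ * ‖η‖ := by
      rw [sub_sub_cancel_left, norm_neg, norm_smul, LinearIsometryEquiv.norm_map,
        Real.norm_of_nonneg hρ.le]
    have e2 : ‖(z - ρ • rotation u η) - (z - ρ * u)‖ = ρ * ‖η - 1‖ := by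
      rw [show (z - ρ • rotation u η) - (z - ρ * u) = -(ρ * u * (η - 1)) by
        simp only [rotation_apply, Complex.real_smul]; ring]
      rw [norm_neg, norm_mul, norm_mul, Circle.norm_coe, mul_one, Complex.norm_real,
        Real.norm_of_nonneg hρ.le]
    have m1 : (z - ρ • rotation u η) ∈ annulus z ρ ↔ η ∈ annulus 0 1 := by
      rw [mem_annulus, mem_annulus, e1, sub_zero, mul_le_iff_le_one_right hρ, div_eq_mul_one_div ρ,
        mul_lt_mul_iff_right₀ hρ]
    have m2 : (z - ρ • rotation u η) ∈ B ↔ η ∈ Metric.closedBall (1 : ℂ) 1 := by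
      rw [hB, mem_closedBall_iff_norm, mem_closedBall_iff_norm, e2, mul_le_iff_le_one_right hρ]
    have e3 : K (z - (z - ρ • rotation u η)) = K (ρ * u) * K η := by
      rw [sub_sub_cancel, ← K_mul, rotation_apply, Complex.real_smul, mul_assoc]
    by_cases h : η ∈ lens
    · rw [Set.indicator_of_mem h, Set.indicator_of_mem (m2.2 h.2), annulusKernel,
        Set.indicator_of_mem (m1.2 h.1), e3]
    · rw [Set.indicator_of_notMem h, Set.indicator_apply_eq_zero]
      exact fun hB' => Set.indicator_of_notMem (fun hA => h ⟨m1.1 hA, m2.1 hB'⟩) _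
  have h2 : ∫ ξ, B.indicator (annulusKernel z ρ) ξ = ρ ^ 2 • (K (ρ * u) * ∫ η in lens, K η) := by
    have hrot := ((rotation u).measurePreserving).integral_comp
      (rotation u).toHomeomorph.measurableEmbedding
      (fun η => B.indicator (annulusKernel z ρ) (z - ρ • η))
    have hscale := Measure.integral_comp_smul_of_nonneg (volume : Measure ℂ)
      (fun ξ => B.indicator (annulusKernel z ρ) (z - ξ)) ρ (hR := hρ.le)
    rw [Complex.finrank_real_complex] at hscale
    rw [← integral_const_mul, ← integral_indicator measurableSet_lens, ← integral_sub_left_eq_self _ _ z,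
      ← integral_congr_ae (ae_of_all _ h1), hrot, hscale, smul_smul, mul_inv_cancel₀ (by positivity),
      one_smul]
  rw [← integral_indicator measurableSet_closedBall, h2, norm_smul, norm_mul, norm_K, norm_mul,
    Circle.norm_coe, Complex.norm_real, Real.norm_of_nonneg hρ.le, norm_pow,
    Real.norm_of_nonneg hρ.le]
  field_simp

/-! ### Comparison of `μ` with Lebesgue measure inside one disc -/

namespace Construction

variable {r : ℕ → ℝ} {C : Construction r} {μ : FiniteMeasure ℂ}

/-- Both integrals are compared with the value at `c` times `r (n + 1)`, which is at once the
`μ`-mass of the disc and the normalized area of the square. -/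
theorem IsWeakSubseqLimit.norm_integral_child_sub_le (hr : IsScaleSequence r)
    (hμ : C.IsWeakSubseqLimit μ) {n : ℕ} {c : ℂ} (hc : c ∈ C.centers (n + 1)) (u : Circle) (z : ℂ)
    {ω : ℝ}
    (hω : ∀ ξ ∈ openSquare c √(Real.pi * r (n + 1) * r n) u,
      ‖annulusKernel z (r n) ξ - annulusKernel z (r n) c‖ ≤ ω) :
    ‖(∫ ξ in bigDisc r (n + 1) c, annulusKernel z (r n) ξ ∂(μ : Measure ℂ)) -
      (Real.pi * r n)⁻¹ • ∫ ξ in openSquare c √(Real.pi * r (n + 1) * r n) u,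
        annulusKernel z (r n) ξ‖ ≤ 2 * ω * r (n + 1) := by
  have h0 := hr.pos n
  set Q := openSquare c √(Real.pi * r (n + 1) * r n) u with hQ
  have hQtop : volume Q ≠ ⊤ := by
    rw [hQ, SparseCantor.volume_openSquare _ _ (Real.sqrt_nonneg _)]
    exact ENNReal.ofReal_ne_top
  have h1 := norm_setIntegral_sub_smul_le (ν := (μ : Measure ℂ))
    (measure_ne_top _ _) (integrableOn_annulusKernel _ z h0 (measure_ne_top _ _))
    fun ξ hξ => hω ξ (hr.bigDisc_subset_openSquare n c u hξ)
  have h2 := norm_setIntegral_sub_smul_le (ν := volume) hQtop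
    (integrableOn_annulusKernel _ z h0 hQtop) hω
  rw [hμ.measureReal_bigDisc hr hc] at h1
  rw [hr.volume_openSquare n c u] at h2
  have h3 : ‖((Real.pi * r n)⁻¹ • ∫ ξ in Q, annulusKernel z (r n) ξ) -
      r (n + 1) • annulusKernel z (r n) c‖ ≤ ω * r (n + 1) := by
    have e : ((Real.pi * r n)⁻¹ • ∫ ξ in Q, annulusKernel z (r n) ξ) -
        r (n + 1) • annulusKernel z (r n) c = (Real.pi * r n)⁻¹ •
          ((∫ ξ in Q, annulusKernel z (r n) ξ) -
            (Real.pi * r (n + 1) * r n) • annulusKernel z (r n) c) := by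
      rw [smul_sub, smul_smul]
      congr 2
      field_simp
    rw [e, norm_smul, Real.norm_of_nonneg (by positivity)]
    refine (mul_le_mul_of_nonneg_left h2 (by positivity)).trans (le_of_eq ?_)
    field_simp
  calc _ ≤ _ := norm_sub_le_norm_sub_add_norm_sub _ (r (n + 1) • annulusKernel z (r n) c) _
    _ ≤ ω * r (n + 1) + ω * r (n + 1) := by
        refine add_le_add h1 ?_
        rw [norm_sub_rev]
        exact h3
    _ = _ := by ring

theorem sum_measureReal_openSquare_le (hr : IsScaleSequence r) {n : ℕ} {w : ℂ} {T : Finset ℂ}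
    (hT : T ⊆ C.children n w) {u : ℂ → Circle}
    (hdisj : (C.children n w : Set ℂ).PairwiseDisjoint
      fun c => openSquare c √(Real.pi * r (n + 1) * r n) (u c))
    {D : Set ℂ} (hD : volume D ≠ ⊤)
    (hsub : ∀ c ∈ T, openSquare c √(Real.pi * r (n + 1) * r n) (u c) ⊆ D) :
    T.card * (Real.pi * r (n + 1) * r n) ≤ volume.real D := by
  have h1 : volume.real (⋃ c ∈ T, openSquare c √(Real.pi * r (n + 1) * r n) (u c)) =
      T.card * (Real.pi * r (n + 1) * r n) := by
    rw [measureReal_biUnion_finset (hdisj.subset (by exact_mod_cast hT))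
      (fun c _ => (isOpen_openSquare _ _ _).measurableSet)
      (fun c hc => ((measure_mono (hsub c hc)).trans_lt hD.lt_top).ne),
      Finset.sum_congr rfl fun c _ => hr.volume_openSquare n c (u c), Finset.sum_const,
      nsmul_eq_mul]
  rw [← h1]
  exact measureReal_mono (Set.iUnion₂_subset hsub) hD

open Classical in
theorem IsWeakSubseqLimit.norm_sum_integral_child_sub_le (hr : IsScaleSequence r)
    (hμ : C.IsWeakSubseqLimit μ) {n : ℕ} {w : ℂ} (hw : w ∈ C.centers n) {u : ℂ → Circle}
    (hdisj : (C.children n w : Set ℂ).PairwiseDisjoint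
      fun c => openSquare c √(Real.pi * r (n + 1) * r n) (u c)) (z : ℂ) :
    ‖∑ c ∈ C.children n w, ((∫ ξ in bigDisc r (n + 1) c, annulusKernel z (r n) ξ ∂(μ : Measure ℂ)) -
      (Real.pi * r n)⁻¹ • ∫ ξ in openSquare c √(Real.pi * r (n + 1) * r n) (u c),
        annulusKernel z (r n) ξ)‖ ≤ 60 * sNext r n := by
  have h0 := hr.pos n
  have h0' := hr.pos (n + 1)
  have hside := hr.side_le n
  have hs := hr.sNext_lt n
  set a := √(Real.pi * r (n + 1) * r n) with ha
  have ha0 : 0 ≤ a := Real.sqrt_nonneg _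
  have hsr : sNext r n * r n ≤ 2 / 5 * r n := by gcongr
  -- Bad squares may straddle a discontinuity of the truncated kernel; for them only the trivial
  -- oscillation bound `4 / r n` is available.
  let bad : ℂ → Prop := fun c => c ∈ closedRing z (r n) a ∨ c ∈ closedRing z (r n / 2) a
  set T := (C.children n w).filter bad with hT
  have hosc : ∀ c ∈ C.children n w, ‖(∫ ξ in bigDisc r (n + 1) c, annulusKernel z (r n) ξ
      ∂(μ : Measure ℂ)) - (Real.pi * r n)⁻¹ • ∫ ξ in openSquare c a (u c),
        annulusKernel z (r n) ξ‖ ≤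
      2 * (12 * a / r n ^ 2) * r (n + 1) + if bad c then 2 * (4 / r n) * r (n + 1) else 0 := by
    intro c hc
    have hc' := C.mem_centers_succ.2 ⟨w, hw, hc⟩
    by_cases hb : bad c
    · rw [if_pos hb]
      refine (hμ.norm_integral_child_sub_le hr hc' (u c) z (ω := 4 / r n) fun ξ _ => ?_).trans ?_
      · refine (norm_sub_le _ _).trans ?_
        have h1 := norm_annulusKernel_le z h0 ξ
        have h2 := norm_annulusKernel_le z h0 c
        calc _ ≤ 2 / r n + 2 / r n := add_le_add h1 h2
          _ = _ := by ring
      · have : 0 ≤ 2 * (12 * a / r n ^ 2) * r (n + 1) := by positivity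
        linarith
    · rw [if_neg hb, add_zero]
      simp only [bad, not_or] at hb
      refine hμ.norm_integral_child_sub_le hr hc' (u c) z fun ξ hξ => ?_
      exact norm_annulusKernel_sub_le h0 (mem_ball_iff_norm.1 (openSquare_subset_ball _ _ _ hξ))
        hb.1 hb.2
  -- Bad squares are few: they are disjoint and lie in two rings of half-width `2a`, of total area
  -- at most `12 π r_n a`.
  have hbad : (T.card : ℝ) * r (n + 1) ≤ 12 * a := by
    have h1 := C.sum_measureReal_openSquare_le hr (T := T) (Finset.filter_subset _ _) hdisj
      (D := closedRing z (r n) (2 * a) ∪ closedRing z (r n / 2) (2 * a))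
      (measure_union_ne_top (volume_closedRing_ne_top _ _ _) (volume_closedRing_ne_top _ _ _)) ?_
    · have h2 := volume_real_closedRing_le z (ρ := r n) (δ := 2 * a) (by linarith) (by linarith)
      have h3 := volume_real_closedRing_le z (ρ := r n / 2) (δ := 2 * a) (by linarith) (by linarith)
      have h4 := measureReal_union_le (μ := volume) (closedRing z (r n) (2 * a)) (closedRing z (r n / 2) (2 * a))
      have h5 : (Real.pi * r n) * (T.card * r (n + 1)) ≤ (Real.pi * r n) * (12 * a) := by
        linarith
      exact le_of_mul_le_mul_left h5 (by positivity)
    · intro c hc ξ hξ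
      have h1 := mem_ball_iff_norm.1 (openSquare_subset_ball _ _ _ hξ)
      have h2 : |‖ξ - z‖ - ‖c - z‖| ≤ a :=
        (abs_norm_sub_norm_le _ _).trans (by simpa using h1.le)
      rcases (Finset.mem_filter.1 hc).2 with h | h
      · left
        refine (abs_sub_le _ ‖c - z‖ _).trans ?_
        have h3 : |‖c - z‖ - r n| ≤ a := h
        linarith
      · right
        refine (abs_sub_le _ ‖c - z‖ _).trans ?_
        have h3 : |‖c - z‖ - r n / 2| ≤ a := h
        linarith
  refine (norm_sum_le_of_le _ hosc).trans ?_
  rw [Finset.sum_add_distrib, Finset.sum_const, ← Finset.sum_filter, Finset.sum_const, nsmul_eq_mul,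
    nsmul_eq_mul, C.card_children hw, ← hT]
  have e1 : r n / r (n + 1) * (2 * (12 * a / r n ^ 2) * r (n + 1)) = 24 * a / r n := by
    field_simp; ring
  have e2 : (T.card : ℝ) * (2 * (4 / r n) * r (n + 1)) = 8 / r n * (T.card * r (n + 1)) := by ring
  rw [e1, e2]
  calc _ ≤ 24 * a / r n + 8 / r n * (12 * a) := by gcongr
    _ = 120 / r n * a := by ring
    _ ≤ 120 / r n * (sNext r n * r n / 2) := by gcongr
    _ = _ := by field_simp; ring

theorem norm_integral_bigDisc_sub_openSquares_le (hr : IsScaleSequence r) {n : ℕ} {w : ℂ}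
    (hw : w ∈ C.centers n) {u : ℂ → Circle}
    (hsub : ∀ c ∈ C.children n w,
      openSquare c √(Real.pi * r (n + 1) * r n) (u c) ⊆ bigDisc r n w)
    (hdisj : (C.children n w : Set ℂ).PairwiseDisjoint
      fun c => openSquare c √(Real.pi * r (n + 1) * r n) (u c)) (z : ℂ) :
    ‖(∑ c ∈ C.children n w, ∫ ξ in openSquare c √(Real.pi * r (n + 1) * r n) (u c),
        annulusKernel z (r n) ξ) - ∫ ξ in bigDisc r n w, annulusKernel z (r n) ξ‖ ≤
      Real.pi * r n * (5 * sNext r n) := by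
  have h0 := hr.pos n
  have h0' := hr.pos (n + 1)
  have hs0 := IsScaleSequence.sNext_nonneg r n
  have hs := hr.sNext_lt n
  have htop : volume (bigDisc r n w) ≠ ⊤ := measure_closedBall_lt_top.ne
  have hm : ∀ c ∈ C.children n w,
      MeasurableSet (openSquare c √(Real.pi * r (n + 1) * r n) (u c)) :=
    fun c _ => (isOpen_openSquare _ _ _).measurableSet
  have hQtop : ∀ c ∈ C.children n w,
      volume (openSquare c √(Real.pi * r (n + 1) * r n) (u c)) ≠ ⊤ :=
    fun c hc => ((measure_mono (hsub c hc)).trans_lt htop.lt_top).ne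
  rw [← integral_biUnion_finset _ hm hdisj
    fun c hc => integrableOn_annulusKernel _ z h0 (hQtop c hc)]
  set U := ⋃ c ∈ C.children n w, openSquare c √(Real.pi * r (n + 1) * r n) (u c) with hU
  have hUsub : U ⊆ bigDisc r n w := Set.iUnion₂_subset hsub
  have hUm : MeasurableSet U := Finset.measurableSet_biUnion _ hm
  have hUtop : volume U ≠ ⊤ := ((measure_mono hUsub).trans_lt htop.lt_top).ne
  -- The squares have exactly the area of the disc before enlargement, so what they leave uncovered
  -- is only the area gained by enlarging.
  have hUvol : volume.real U = Real.pi * r n ^ 2 := by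
    rw [hU, measureReal_biUnion_finset hdisj hm hQtop,
      Finset.sum_congr rfl fun c _ => hr.volume_openSquare n c (u c), Finset.sum_const,
      nsmul_eq_mul, C.card_children hw]
    field_simp
  have hdiff : volume.real (bigDisc r n w \ U) =
      Real.pi * r n ^ 2 * ((1 + sNext r n) ^ 2 - 1) := by
    rw [measureReal_sdiff hUsub hUm htop, hUvol, bigDisc,
      volume_real_closedBall w (hr.bigRadius_pos n).le]
    ring
  refine (norm_setIntegral_sub_setIntegral_le (norm_annulusKernel_le z h0) hUm
    (measurableSet_bigDisc n w) ((measurableSet_bigDisc n w).diff hUm)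
    (integrableOn_annulusKernel _ z h0 hUtop) (integrableOn_annulusKernel _ z h0 htop)
    ((measure_mono Set.sdiff_subset).trans_lt htop.lt_top).ne ?_).trans ?_
  · rw [symmDiff_of_le hUsub]
  · rw [hdiff]
    have e : 2 / r n * (Real.pi * r n ^ 2 * ((1 + sNext r n) ^ 2 - 1)) =
        Real.pi * r n * (2 * ((1 + sNext r n) ^ 2 - 1)) := by
      field_simp
    rw [e]
    refine mul_le_mul_of_nonneg_left ?_ (by positivity)
    nlinarith

end Construction

/-- The integral over a disc whose boundary passes close to `z` is close to the model integral. -/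
theorem norm_integral_closedBall_ge (z w : ℂ) {ρ s κ : ℝ} (hρ : 0 < ρ) (hs : 0 ≤ s)
    (hsκ : 2 * s + κ ≤ 1) (hz : |dist z w - (1 + s) * ρ| ≤ κ * ρ) :
    ρ * ‖∫ η in lens, K η‖ - Real.pi * ρ * (8 * (2 * s + κ)) ≤
      ‖∫ ξ in Metric.closedBall w ((1 + s) * ρ), annulusKernel z ρ ξ‖ := by
  obtain ⟨u, hu⟩ : ∃ u : Circle, z - w = (‖z - w‖ : ℂ) * u := by
    by_cases h : z - w = 0
    · exact ⟨1, by simp [h]⟩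
    · have h' : (‖z - w‖ : ℂ) ≠ 0 := by simpa using h
      refine ⟨⟨(z - w) / ‖z - w‖, ?_⟩, ?_⟩
      · simp [Submonoid.unitSphere, h]
      · simp only
        field_simp
  -- The model disc has radius exactly `ρ`, passes through `z`, and has its centre on the ray from
  -- `z` through `w`. Centres differ by at most `(s + κ) ρ` and radii by `s ρ`, which gives the
  -- half-width `(2s + κ) ρ` below.
  set w' : ℂ := z - ρ * u with hw'
  have hκ : 0 ≤ κ := by
    by_contra! h
    have := (abs_nonneg _).trans hz
    nlinarith
  have hd : ‖w - w'‖ ≤ (s + κ) * ρ := by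
    have e : w - w' = ((ρ - ‖z - w‖ : ℝ) : ℂ) * u := by
      push_cast
      linear_combination -hu
    rw [e, norm_mul, Circle.norm_coe, mul_one, Complex.norm_real, Real.norm_eq_abs, abs_le]
    rw [dist_eq_norm, abs_le] at hz
    constructor <;> nlinarith
  have hsub : symmDiff (Metric.closedBall w' ρ) (Metric.closedBall w ((1 + s) * ρ)) ⊆
      closedRing w' ρ ((2 * s + κ) * ρ) := by
    intro ξ hξ
    rw [Set.mem_symmDiff] at hξ
    simp only [mem_closedBall_iff_norm, not_le] at hξ
    rw [closedRing, Set.mem_ofPred_eq, abs_le]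
    have h1 : ‖ξ - w'‖ ≤ ‖ξ - w‖ + ‖w - w'‖ := norm_sub_le_norm_sub_add_norm_sub _ _ _
    have h2 : ‖ξ - w‖ ≤ ‖ξ - w'‖ + ‖w - w'‖ := by
      rw [norm_sub_rev w w']
      exact norm_sub_le_norm_sub_add_norm_sub _ _ _
    have h3 : 0 ≤ s * ρ := by positivity
    have h4 : 0 ≤ κ * ρ := by positivity
    rcases hξ with ⟨h5, h6⟩ | ⟨h5, h6⟩ <;> constructor <;> linarith
  have h1 := norm_setIntegral_sub_setIntegral_le (norm_annulusKernel_le z hρ)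
    measurableSet_closedBall measurableSet_closedBall (measurableSet_closedRing _ _ _)
    (integrableOn_annulusKernel _ z hρ measure_closedBall_lt_top.ne)
    (integrableOn_annulusKernel _ z hρ measure_closedBall_lt_top.ne)
    (volume_closedRing_ne_top _ _ _) hsub
  have h2 := volume_real_closedRing_le w' (ρ := ρ) (δ := (2 * s + κ) * ρ) (by positivity) (by nlinarith)
  have h3 := norm_integral_annulusKernel z hρ u
  have h4 := norm_sub_norm_le (∫ ξ in Metric.closedBall w' ρ, annulusKernel z ρ ξ)
    (∫ ξ in Metric.closedBall w ((1 + s) * ρ), annulusKernel z ρ ξ)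
  have h5 : 2 / ρ * volume.real (closedRing w' ρ ((2 * s + κ) * ρ)) ≤
      2 / ρ * (4 * Real.pi * ρ * ((2 * s + κ) * ρ)) := by gcongr
  have h6 : 2 / ρ * (4 * Real.pi * ρ * ((2 * s + κ) * ρ)) = Real.pi * ρ * (8 * (2 * s + κ)) := by
    field_simp; ring
  linarith

/-! ### Lower bound for the annulus integral near the boundary of an enlarged disc -/

namespace Construction

variable {r : ℕ → ℝ} {C : Construction r} {μ : FiniteMeasure ℂ}

/-- Another generation-`n` disc meeting the annulus would have its centre closer to `w` than `7/5 +
1 + 8/5 = 4` times `r n`, against the separation of centres. -/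
theorem IsWeakSubseqLimit.integral_annulus_eq (hr : IsScaleSequence r)
    (hμ : C.IsWeakSubseqLimit μ) {n : ℕ} {w z : ℂ} (hw : w ∈ C.centers n)
    (hz : dist z w ≤ 8 / 5 * r n) :
    ∫ ξ in annulus z (r n), K (z - ξ) ∂(μ : Measure ℂ) =
      ∑ c ∈ C.children n w, ∫ ξ in bigDisc r (n + 1) c, annulusKernel z (r n) ξ
        ∂(μ : Measure ℂ) := by
  have h0 := hr.pos n
  rw [← integral_indicator (measurableSet_annulus z (r n))]
  change ∫ ξ, annulusKernel z (r n) ξ ∂(μ : Measure ℂ) = _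
  rw [← integral_biUnion_finset _ (fun c _ => measurableSet_bigDisc (n + 1) c)
    ((C.pairwiseDisjoint_bigDisc hr (n + 1)).subset fun c hc => C.mem_centers_succ.2 ⟨w, hw, hc⟩)
    (fun c _ => integrableOn_annulusKernel _ z h0 (measure_ne_top _ _)),
    ← integral_indicator (Finset.measurableSet_biUnion _ fun c _ => measurableSet_bigDisc (n + 1) c)]
  refine integral_congr_ae ?_
  filter_upwards [hμ.ae_mem_bigDisc hr (n + 1)] with ξ ⟨c, hc, hξ⟩
  obtain ⟨w', hw', hcw'⟩ := C.mem_centers_succ.1 hc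
  by_cases h : w' = w
  · subst h
    exact (Set.indicator_of_mem (Set.mem_iUnion₂.2 ⟨c, hcw', hξ⟩) _).symm
  · have h1 : ξ ∉ annulus z (r n) := by
      intro h2
      have h3 := (mem_annulus.1 h2).1
      have h4 : dist ξ w' ≤ _ := C.bigDisc_child_subset hr hw' hcw' hξ
      have h5 := hr.bigRadius_lt n
      have h6 := C.dist_centers hr hw' hw h
      rw [← dist_eq_norm] at h3
      have h7 := dist_triangle4 w' ξ z w
      rw [dist_comm w' ξ] at h7
      linarith
    have h2 : annulusKernel z (r n) ξ = 0 := Set.indicator_of_notMem h1 _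
    rw [h2, Set.indicator_apply_eq_zero.2 fun _ => h2]

theorem IsWeakSubseqLimit.norm_integral_annulus_ge (hr : IsScaleSequence r)
    (hμ : C.IsWeakSubseqLimit μ) {n : ℕ} {w z : ℂ} {κ : ℝ} (hκ : κ ≤ 1 / 5)
    (hw : w ∈ C.centers n)
    (hz : Metric.infDist z (frontier (bigDisc r n w)) ≤ κ * r n) :
    Real.pi⁻¹ * ‖∫ η in lens, K η‖ - 81 * sNext r n - 8 * κ ≤
      ‖∫ ξ in annulus z (r n), K (z - ξ) ∂(μ : Measure ℂ)‖ := by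
  have h0 := hr.pos n
  have hs0 := IsScaleSequence.sNext_nonneg r n
  have hs := hr.sNext_lt n
  rw [infDist_frontier_bigDisc hr] at hz
  have hκr : κ * r n ≤ 1 / 5 * r n := by gcongr
  have hR := hr.bigRadius_lt n
  rw [hμ.integral_annulus_eq hr hw (by linarith [(abs_le.1 hz).2])]
  obtain ⟨u, hsub, hdisj⟩ := C.exists_openSquares hw
  have h1 := hμ.norm_sum_integral_child_sub_le hr hw hdisj z
  have h2 := norm_integral_bigDisc_sub_openSquares_le hr hw hsub hdisj z
  have h3 := norm_integral_closedBall_ge z w h0 hs0 (by linarith) hz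
  rw [Finset.sum_sub_distrib, ← Finset.smul_sum] at h1
  set X := ∑ c ∈ C.children n w, ∫ ξ in bigDisc r (n + 1) c, annulusKernel z (r n) ξ
    ∂(μ : Measure ℂ)
  set Y := ∑ c ∈ C.children n w, ∫ ξ in openSquare c √(Real.pi * r (n + 1) * r n) (u c),
    annulusKernel z (r n) ξ
  change ‖Y - ∫ ξ in Metric.closedBall w ((1 + sNext r n) * r n), annulusKernel z (r n) ξ‖ ≤ _ at h2
  set Z := ∫ ξ in Metric.closedBall w ((1 + sNext r n) * r n), annulusKernel z (r n) ξ
  have h4 : ‖Z‖ - Real.pi * r n * (5 * sNext r n) ≤ ‖Y‖ := by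
    have := norm_sub_norm_le Z Y
    rw [norm_sub_rev] at this
    linarith
  have h5 : ‖(Real.pi * r n)⁻¹ • Y‖ - 60 * sNext r n ≤ ‖X‖ := by
    have := norm_sub_norm_le ((Real.pi * r n)⁻¹ • Y) X
    rw [norm_sub_rev] at this
    linarith
  rw [norm_smul, Real.norm_of_nonneg (by positivity)] at h5
  have h6 : (Real.pi * r n)⁻¹ * (r n * ‖∫ η in lens, K η‖ -
      Real.pi * r n * (8 * (2 * sNext r n + κ)) - Real.pi * r n * (5 * sNext r n)) ≤
      (Real.pi * r n)⁻¹ * ‖Y‖ := by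
    gcongr
    linarith
  have h7 : (Real.pi * r n)⁻¹ * (r n * ‖∫ η in lens, K η‖ -
      Real.pi * r n * (8 * (2 * sNext r n + κ)) - Real.pi * r n * (5 * sNext r n)) =
      Real.pi⁻¹ * ‖∫ η in lens, K η‖ - 8 * (2 * sNext r n + κ) - 5 * sNext r n := by
    field_simp
  -- The coefficient 81 is 60 (`μ` against area on squares) plus 16 (disc against model disc) plus 5
  -- (uncovered area).
  linarith

end Construction

namespace Construction

variable {r : ℕ → ℝ} {C : Construction r} {μ : FiniteMeasure ℂ}

/-! ### Points close to the boundary of an enlarged disc -/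

open Classical in
/-- Few children of a disc contain points far from the boundary of the enlarged disc. -/
theorem card_children_far_le (hr : IsScaleSequence r) {n : ℕ} {w : ℂ} (hw : w ∈ C.centers n)
    {κ : ℝ} (hκ : κ ≤ 1) (hs : sNext r n ≤ κ / 4) :
    (((C.children n w).filter fun c => ∃ z ∈ bigDisc r (n + 1) c,
      κ * r n < Metric.infDist z (frontier (bigDisc r n w))).card : ℝ) * r (n + 1) ≤
      (1 - κ / 2) ^ 2 * r n := by
  have h0 := hr.pos n
  have h0' := hr.pos (n + 1)
  have hs0 := IsScaleSequence.sNext_nonneg r n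
  obtain ⟨u, hsub, hdisj⟩ := C.exists_openSquares hw
  set T := (C.children n w).filter fun c => ∃ z ∈ bigDisc r (n + 1) c,
    κ * r n < Metric.infDist z (frontier (bigDisc r n w)) with hT
  have h1 := C.sum_measureReal_openSquare_le hr (T := T) (Finset.filter_subset _ _) hdisj
    (D := Metric.closedBall w ((1 - κ / 2) * r n)) measure_closedBall_lt_top.ne ?_
  · rw [volume_real_closedBall w (by nlinarith)] at h1
    have h2 : (Real.pi * r n) * (T.card * r (n + 1)) ≤
        (Real.pi * r n) * ((1 - κ / 2) ^ 2 * r n) := by linarith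
    exact le_of_mul_le_mul_left h2 (by positivity)
  -- The point `z` is within `(1 + s - κ) r_n` of `w`, and `ξ` within two sides, at most `s r_n`, of
  -- `z`. With `s ≤ κ / 4` the whole square lies in the disc of radius `(1 - κ/2) r_n`.
  · intro c hc ξ hξ
    obtain ⟨hcw, z, hz, hfar⟩ := Finset.mem_filter.1 hc
    rw [infDist_frontier_bigDisc hr] at hfar
    have hzw : dist z w ≤ (1 + sNext r n) * r n := C.bigDisc_child_subset hr hw hcw hz
    rw [abs_of_nonpos (by linarith)] at hfar
    have h2 := Metric.mem_ball.1 (openSquare_subset_ball _ _ _ hξ)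
    have h3 := Metric.mem_ball.1
      (openSquare_subset_ball _ _ _ (hr.bigDisc_subset_openSquare n c (u c) hz))
    have h4 := hr.side_le n
    have h5 := dist_triangle4 ξ c z w
    rw [dist_comm c z] at h5
    have h6 : sNext r n * r n ≤ κ / 4 * r n := by gcongr
    rw [Metric.mem_closedBall]
    linarith

-- The bound on far children holds under every parent separately, so the factors multiply along
-- generations without any independence.
open Classical in
theorem IsWeakSubseqLimit.exists_cover_far (hr : IsScaleSequence r)
    (hμ : C.IsWeakSubseqLimit μ) {κ : ℝ} (hκ : κ ≤ 1) {M : ℕ}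
    (hs : ∀ n ≥ M, sNext r n ≤ κ / 4) (k : ℕ) :
    ∃ T ⊆ C.centers (M + k), (T.card : ℝ) * r (M + k) ≤ ((1 - κ / 2) ^ 2) ^ k ∧
      ∀ᵐ z ∂(μ : Measure ℂ), (∀ n ≥ M, ∀ w ∈ C.centers n,
        κ * r n < Metric.infDist z (frontier (bigDisc r n w))) → ∃ c ∈ T, z ∈ bigDisc r (M + k) c := by
  induction k with
  | zero =>
    refine ⟨C.centers M, subset_rfl, by simp [C.card_centers hr M], ?_⟩
    filter_upwards [hμ.ae_mem_bigDisc hr M] with z hz _ using hz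
  | succ k ih =>
    obtain ⟨T, hT, hcard, hcov⟩ := ih
    refine ⟨T.biUnion fun w => (C.children (M + k) w).filter fun c =>
      ∃ z ∈ bigDisc r (M + k + 1) c,
        κ * r (M + k) < Metric.infDist z (frontier (bigDisc r (M + k) w)), ?_, ?_, ?_⟩
    · intro c hc
      obtain ⟨w, hw, hcw⟩ := Finset.mem_biUnion.1 hc
      exact C.mem_centers_succ.2 ⟨w, hT hw, (Finset.mem_filter.1 hcw).1⟩
    · have h0 := hr.pos (M + k + 1)
      calc _ ≤ (∑ w ∈ T, (((C.children (M + k) w).filter fun c =>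
            ∃ z ∈ bigDisc r (M + k + 1) c,
              κ * r (M + k) < Metric.infDist z (frontier (bigDisc r (M + k) w))).card : ℝ)) *
              r (M + k + 1) := by
            rw [← add_assoc]
            gcongr
            exact_mod_cast Finset.card_biUnion_le
        _ ≤ ∑ _w ∈ T, (1 - κ / 2) ^ 2 * r (M + k) := by
            rw [Finset.sum_mul]
            exact Finset.sum_le_sum fun w hw =>
              card_children_far_le hr (hT hw) hκ (hs _ (Nat.le_add_right _ _))
        _ = (1 - κ / 2) ^ 2 * (T.card * r (M + k)) := by
            rw [Finset.sum_const, nsmul_eq_mul]; ring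
        _ ≤ (1 - κ / 2) ^ 2 * ((1 - κ / 2) ^ 2) ^ k := by gcongr
        _ = _ := by ring
    · filter_upwards [hcov, hμ.ae_mem_bigDisc hr (M + k + 1)] with z hz ⟨c, hc, hzc⟩ hfar
      obtain ⟨w, hw, hzw⟩ := hz hfar
      obtain ⟨w', hw', hcw'⟩ := C.mem_centers_succ.1 hc
      -- Disjointness identifies the parent of the disc now containing `z` with the disc selected
      -- one generation earlier.
      obtain rfl := C.eq_of_mem_bigDisc hr hw' (hT hw) (C.bigDisc_child_subset hr hw' hcw' hzc) hzw
      exact ⟨c, Finset.mem_biUnion.2 ⟨w', hw, Finset.mem_filter.2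
        ⟨hcw', z, hzc, hfar _ (Nat.le_add_right _ _) _ hw'⟩⟩, hzc⟩

theorem IsWeakSubseqLimit.ae_exists_near (hr : IsScaleSequence r)
    (hμ : C.IsWeakSubseqLimit μ) {κ : ℝ} (hκ0 : 0 < κ) (hκ : κ ≤ 1) {M : ℕ}
    (hs : ∀ n ≥ M, sNext r n ≤ κ / 4) :
    ∀ᵐ z ∂(μ : Measure ℂ), ∃ n ≥ M, ∃ w ∈ C.centers n,
      Metric.infDist z (frontier (bigDisc r n w)) ≤ κ * r n := by
  set X := {z : ℂ | ∀ n ≥ M, ∀ w ∈ C.centers n,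
    κ * r n < Metric.infDist z (frontier (bigDisc r n w))} with hX
  have hle : ∀ k : ℕ, (μ : Measure ℂ).real X ≤ ((1 - κ / 2) ^ 2) ^ k := by
    intro k
    obtain ⟨T, hT, hcard, hcov⟩ := hμ.exists_cover_far hr hκ hs k
    calc (μ : Measure ℂ).real X ≤ (μ : Measure ℂ).real (⋃ c ∈ T, bigDisc r (M + k) c) := by
          refine ENNReal.toReal_mono (measure_ne_top _ _) (measure_mono_ae ?_)
          filter_upwards [hcov] with z hz hzX
          obtain ⟨c, hc, hzc⟩ := hz hzX
          exact Set.mem_biUnion (s := {c | c ∈ T}) hc hzc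
      _ ≤ ∑ c ∈ T, (μ : Measure ℂ).real (bigDisc r (M + k) c) := measureReal_biUnion_finset_le _ _
      _ = T.card * r (M + k) := by
          rw [Finset.sum_congr rfl fun c hc => hμ.measureReal_bigDisc hr (hT hc), Finset.sum_const,
            nsmul_eq_mul]
      _ ≤ _ := hcard
  have hq : Tendsto (fun k : ℕ => ((1 - κ / 2) ^ 2) ^ k) atTop (𝓝 0) :=
    tendsto_pow_atTop_nhds_zero_of_lt_one (by positivity) (by nlinarith)
  have h0 : (μ : Measure ℂ).real X = 0 :=
    le_antisymm (ge_of_tendsto' hq hle) measureReal_nonneg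
  rw [measureReal_eq_zero_iff] at h0
  filter_upwards [measure_eq_zero_iff_ae_notMem.1 h0] with z hz
  simpa [hX] using hz

/-- The starting generation in `ae_exists_near` is arbitrary beyond `N`; a countable intersection
over starting points gives infinitely many `n`. -/
theorem IsWeakSubseqLimit.ae_frequently_near (hr : IsScaleSequence r)
    (hμ : C.IsWeakSubseqLimit μ) {κ : ℝ} (hκ0 : 0 < κ) (hκ : κ ≤ 1) {N : ℕ}
    (hs : ∀ n ≥ N, sNext r n ≤ κ / 4) :
    ∀ᵐ z ∂(μ : Measure ℂ), ∃ᶠ n in atTop, ∃ w ∈ C.centers n,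
      Metric.infDist z (frontier (bigDisc r n w)) ≤ κ * r n := by
  have h : ∀ᵐ z ∂(μ : Measure ℂ), ∀ m : ℕ, ∃ n ≥ max m N, ∃ w ∈ C.centers n,
      Metric.infDist z (frontier (bigDisc r n w)) ≤ κ * r n :=
    ae_all_iff.2 fun m => hμ.ae_exists_near hr hκ0 hκ fun n hn => hs n ((le_max_right _ _).trans hn)
  filter_upwards [h] with z hz
  refine frequently_atTop.2 fun m => ?_
  obtain ⟨n, hn, hw⟩ := hz m
  exact ⟨n, (le_max_left _ _).trans hn, hw⟩

end Construction

/-! ### Principal values -/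

theorem IsScaleSequence.tendsto_zero {r : ℕ → ℝ} (hr : IsScaleSequence r) :
    Tendsto r atTop (𝓝 0) := by
  have h : ∀ n, r n ≤ (1 / 100) ^ n := by
    intro n
    induction n with
    | zero => simp [hr.zero]
    | succ n ih =>
      rw [pow_succ]
      linarith [hr.lt n]
  exact squeeze_zero (fun n => (hr.pos n).le) h
    (tendsto_pow_atTop_nhds_zero_of_lt_one (by norm_num) (by norm_num))

theorem integrableOn_K_truncated (μ : FiniteMeasure ℂ) {ε : ℝ} (hε : 0 < ε) (z : ℂ) {A : Set ℂ}
    (hA : MeasurableSet A) (h : A ⊆ {ξ : ℂ | ε < ‖z - ξ‖}) :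
    IntegrableOn (fun ξ => K (z - ξ)) A (μ : Measure ℂ) := by
  refine Measure.integrableOn_of_bounded (M := ε⁻¹) (measure_ne_top _ _)
    (measurable_K.comp (by fun_prop)).aestronglyMeasurable ?_
  filter_upwards [ae_restrict_mem hA] with ξ hξ
  have h1 : ε < ‖z - ξ‖ := h hξ
  rw [norm_K]
  gcongr

theorem truncatedIntegral_half_sub (μ : FiniteMeasure ℂ) {ρ : ℝ} (hρ : 0 < ρ) (z : ℂ) :
    truncatedIntegral (μ : Measure ℂ) (ρ / 2) z - truncatedIntegral (μ : Measure ℂ) ρ z =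
      ∫ ξ in annulus z ρ, K (z - ξ) ∂(μ : Measure ℂ) := by
  have hm : MeasurableSet {ξ : ℂ | ρ < ‖z - ξ‖} := measurableSet_lt measurable_const (by fun_prop)
  have hunion : {ξ : ℂ | ρ / 2 < ‖z - ξ‖} = annulus z ρ ∪ {ξ : ℂ | ρ < ‖z - ξ‖} := by
    ext ξ
    rw [Set.mem_union, mem_annulus, norm_sub_rev]
    simp only [Set.mem_ofPred_eq]
    constructor
    · intro h
      by_cases h1 : ‖z - ξ‖ ≤ ρ
      · exact Or.inl ⟨h1, h⟩
      · exact Or.inr (not_le.1 h1)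
    · rintro (h | h)
      · exact h.2
      · linarith
  have hdisj : Disjoint (annulus z ρ) {ξ : ℂ | ρ < ‖z - ξ‖} := by
    refine Set.disjoint_left.2 fun ξ h1 h2 => ?_
    have h3 : ρ < ‖z - ξ‖ := h2
    have h4 := (mem_annulus.1 h1).1
    rw [norm_sub_rev] at h4
    linarith
  rw [truncatedIntegral, truncatedIntegral, hunion, setIntegral_union hdisj hm
    (integrableOn_K_truncated μ (half_pos hρ) z (measurableSet_annulus z ρ) ?_)
    (integrableOn_K_truncated μ hρ z hm subset_rfl), add_sub_cancel_right]
  rw [hunion]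
  exact Set.subset_union_left

/-- Principal values do not exist where the integrals over infinitely many annuli are large. -/
theorem not_principalValueExists {μ : FiniteMeasure ℂ} {z : ℂ} {ρ : ℕ → ℝ} (hρ : ∀ n, 0 < ρ n)
    (hlim : Tendsto ρ atTop (𝓝 0)) {κ : ℝ} (hκ : 0 < κ)
    (h : ∃ᶠ n in atTop, κ ≤ ‖∫ ξ in annulus z (ρ n), K (z - ξ) ∂(μ : Measure ℂ)‖) :
    ¬ PrincipalValueExists (μ : Measure ℂ) z := by
  rintro ⟨L, hL⟩
  have h1 : Tendsto ρ atTop (𝓝[>] 0) :=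
    tendsto_nhdsWithin_iff.2 ⟨hlim, Eventually.of_forall hρ⟩
  have h2 : Tendsto (fun n => ρ n / 2) atTop (𝓝[>] 0) :=
    tendsto_nhdsWithin_iff.2
      ⟨by simpa using hlim.div_const 2, Eventually.of_forall fun n => half_pos (hρ n)⟩
  -- Truncations at `ρ n / 2` and `ρ n` would share the limit `L`, so the annulus integrals would
  -- tend to 0.
  have h3 := ((hL.comp h2).sub (hL.comp h1)).norm
  rw [sub_self, norm_zero] at h3
  refine h ?_
  filter_upwards [h3.eventually_lt_const hκ] with n hn
  simp only [Function.comp_apply] at hn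
  rw [truncatedIntegral_half_sub μ (hρ n) z] at hn
  exact not_le.2 hn

end SparseCantor

/-! ### Choice of constants and conclusion -/

theorem mainTheorem2 :
    ∃ c₀ : ℝ, 0 < c₀ ∧
      ∀ r : ℕ → ℝ, SparseCantor.IsScaleSequence r →
        ∃ N : ℕ, ∀ (C : SparseCantor.Construction r) (μ : FiniteMeasure ℂ),
          C.IsWeakSubseqLimit μ →
            (∀ n ≥ N, ∀ w ∈ C.centers n, ∀ z : ℂ,
              Metric.infDist z (frontier (SparseCantor.bigDisc r n w)) ≤ c₀ * r n →
                c₀ ≤ ‖∫ ξ in SparseCantor.annulus z (r n), SparseCantor.K (z - ξ)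
                  ∂(μ : Measure ℂ)‖) ∧
            (∀ᵐ z ∂(μ : Measure ℂ), ∃ᶠ n in atTop, ∃ w ∈ C.centers n,
              Metric.infDist z (frontier (SparseCantor.bigDisc r n w)) ≤ c₀ * r n) ∧
            (∀ᵐ z ∂(μ : Measure ℂ), ¬ SparseCantor.PrincipalValueExists (μ : Measure ℂ) z) := by
  set I := Real.pi⁻¹ * ‖∫ η in SparseCantor.lens, SparseCantor.K η‖ with hI
  have hI0 : 0 < I :=
    mul_pos (inv_pos.2 Real.pi_pos) (norm_pos_iff.2 SparseCantor.integral_K_lens_ne_zero)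
  -- With `81 * sNext r n ≤ c₀` the lower bound is at least `20 c₀ - c₀ - 8 c₀ ≥ c₀`. The cap `1/5`
  -- keeps `z` within `8/5 * r n` of the centre.
  set c₀ := min (I / 20) (1 / 5) with hc₀
  have hc : 0 < c₀ := lt_min (by positivity) (by norm_num)
  have hcI : c₀ ≤ I / 20 := min_le_left _ _
  have hc5 : c₀ ≤ 1 / 5 := min_le_right _ _
  refine ⟨c₀, hc, fun r hr => ?_⟩
  obtain ⟨N, hN⟩ := eventually_atTop.1
    (hr.tendsto_sNext.eventually_le_const (show (0 : ℝ) < c₀ / 81 by positivity))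
  refine ⟨N, fun C μ hμ => ?_⟩
  have h1 : ∀ n ≥ N, ∀ w ∈ C.centers n, ∀ z : ℂ,
      Metric.infDist z (frontier (SparseCantor.bigDisc r n w)) ≤ c₀ * r n →
        c₀ ≤ ‖∫ ξ in SparseCantor.annulus z (r n), SparseCantor.K (z - ξ) ∂(μ : Measure ℂ)‖ := by
    intro n hn w hw z hz
    have := hμ.norm_integral_annulus_ge hr hc5 hw hz
    have := hN n hn
    linarith
  have h2 := hμ.ae_frequently_near hr hc (by linarith) (N := N)
    fun n hn => (hN n hn).trans (by linarith)
  refine ⟨h1, h2, ?_⟩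
  filter_upwards [h2] with z hz
  refine SparseCantor.not_principalValueExists hr.pos hr.tendsto_zero hc ?_
  refine (hz.and_eventually (eventually_ge_atTop N)).mono ?_
  rintro n ⟨⟨w, hw, hzw⟩, hn⟩
  exact h1 n hn w hw z hzw
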